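/- **Setting.** Let $x_1,\dots,x_N\in\mathbb R^m$ ($N\ge1$), $y_i\in\{1,-1\}$, $\lambda\ge 0$, $\beta\in(0,1)$, $c_1\in(0,1)$. Put $\psi(u)=\tfrac12\bigl(u+\sqrt{1+u^2}\bigr)$ and $$\hat f(w)=\tfrac{\lambda}{2}\|w\|^2+\tfrac1N\sum_{i=1}^N\max(0,1-y_iw^Tx_i),\qquad \hat f_\alpha(w)=\tfrac{\lambda}{2}\|w\|^2+\tfrac1N\sum_{i=1}^N\alpha\,\psi\Bigl(\frac{1-y_iw^Tx_i}{\alpha}\Bigr)\quad(\alpha>0).$$ *Guarded Newton method.* For a smooth function $F$ on $\mathbb R^m$ with invertible Hessian let $\delta_F(w)=-(\operatorname{Hess}F(w))^{-1}\nabla F(w)$ and $\Lambda_F(w)=|\delta_F(w)^T\nabla F(w)|$. A guarded Newton step replaces $w$ by $w+s\,\delta_F(w)$, where $s$ is the first of $1,\frac12,\frac14,\dots$ that passes the Armijo test $F(w+s\delta_F(w))\le F(w)+c_1s\,\delta_F(w)^T\nabla F(w)$. Let $n(F,t,w)$ be the number of guarded Newton steps taken from $w$ until $\Lambda_F<t$.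 For smoothing parameter $\alpha$ the method is applied to $F=\hat f_\alpha$ with $t=\eta\alpha$; once $\Lambda_{\hat f_\alpha}(w)<\eta\alpha$, the parameter $\alpha$ is replaced by $\beta\alpha$ and the method continues from the same $w$. *Assumptions.* Let $w^*$ minimize $\hat f$. Assume that $I=\{i: y_ix_i^Tw^*=1\}$ has exactly $m$ elements, that $(x_i)_{i\in I}$ is linearly independent, and that the solution $\theta=(\theta_i)_{i\in I}$ of $$\sum_{i\in I}\theta_iy_ix_i+\sum_{j:\,y_jx_j^Tw^*<1}y_jx_j-N\lambda w^*=0$$ satisfies $0<\theta_i<1$ for all $i\in I$. Put $$\tilde f(\omega)=\sum_{i\in I}\bigl[\psi(y_ix_i^T\omega)-\theta_iy_ix_i^T\omega\bigr],$$ a function that involves neither $\alpha$ nor any data point outside $I$ (other than through $\theta$). **Statement.** The function $\tilde f$ has a unique (strict global) minimizer $d$, and the following hold. 1. There is $\eta_0>0$ such that for every $\eta\in(0,\eta_0)$: (a) there is $M$ such that every run of the guarded Newton method on $\tilde f$, with tolerance $N\eta$, from any starting point $\omega_0$ with $\Lambda_{\tilde f}(\beta\omega_0)\le N\eta$, takes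 at most $M$ steps; here any Armijo or stopping test that holds with equality may be decided either way; (b) there is $\alpha_0>0$ such that for all $\alpha\in(0,\alpha_0)$ and every $w$ with $\Lambda_{\hat f_\alpha}(w)<\eta\alpha$, the number $n(\hat f_{\beta\alpha},\eta\beta\alpha,w)$ of guarded Newton steps needed after reducing $\alpha$ to $\beta\alpha$ is finite and equals the number of steps of one of the runs described in (a). 2. Let $(\omega_k)_{k\ge0}$ be the iterates of the guarded Newton method on $\tilde f$ from $\omega_0=\beta^{-1}d$, without stopping. Suppose that $\omega_k\ne d$ for all $k$, that no Armijo test carried out along $(\omega_k)$ holds with equality, and that $c_1\notin\{\frac12,\frac34,\frac78,\dots\}$. Then for every $\varepsilon\in(0,1)$ there is $\eta_0>0$ such that for every $\eta\in(0,\eta_0)$ the numbers $$n_1=n\bigl(\tilde f,(1+\varepsilon)N\eta,\beta^{-1}d\bigr),\qquad n_2=n\bigl(\tilde f,(1-\varepsilon)N\eta,\beta^{-1}d\bigr)$$ are finite, $n_2\le n_1+1$ if $c_1<\frac12$, and there is $\alpha_0>0$ with $$n_1\le n(\hat f_{\beta\alpha},\eta\beta\alpha,w)\le n_2\qquad\text{for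 all }\alpha\in(0,\alpha_0)\text{ and all }w\text{ with }\Lambda_{\hat f_\alpha}(w)<\eta\alpha .$$ In particular, whenever $n_1=n_2$, the number of steps is the same for every $\alpha\in(0,\alpha_0)$. -/

import Mathlib

open scoped BigOperators

noncomputable section

namespace SmSVM

/-! ### The guarded Newton method (Newton direction, Armijo backtracking by halving from step 1) -/

section GuardedNewton

variable {E : Type*} [NormedAddCommGroup E] [InnerProductSpace ℝ E] [CompleteSpace E]

/-- Newton direction `- (Hess f w)⁻¹ ∇ f w`. -/
def newtonDir (f : E → ℝ) (w : E) : E :=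
  -((fderiv ℝ (gradient f) w).inverse (gradient f w))

/-- Predicted reduction `|dᵀ g|`, with `d` the Newton direction and `g` the gradient at `w`. -/
def predictedReduction (f : E → ℝ) (w : E) : ℝ :=
  |inner ℝ (newtonDir f w) (gradient f w)|

/-- Value of `f` at the trial point with step length `2⁻ʲ` along the Newton direction. -/
def trialValue (f : E → ℝ) (w : E) (j : ℕ) : ℝ :=
  f (w + ((1 / 2 : ℝ) ^ j) • newtonDir f w)

/-- Right-hand side of the Armijo test with sufficient decrease parameter `c` and step `2⁻ʲ`. -/
def armijoBound (f : E → ℝ) (c : ℝ) (w : E) (j : ℕ) : ℝ :=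
  f w + c * (1 / 2 : ℝ) ^ j * inner ℝ (newtonDir f w) (gradient f w)

/-- `w'` is the result of one guarded Newton step from `w`: the step length is the first of
`1, 1/2, 1/4, …` that passes the Armijo test. -/
def IsGuardedStep (f : E → ℝ) (c : ℝ) (w w' : E) : Prop :=
  ∃ j : ℕ, trialValue f w j ≤ armijoBound f c w j ∧
    (∀ i < j, armijoBound f c w i < trialValue f w i) ∧
    w' = w + ((1 / 2 : ℝ) ^ j) • newtonDir f w

/-- The guarded Newton method for `f`, started at `w₀` and stopped as soon as the predicted
reduction is less than `tol`, takes exactly `n` steps. -/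
def StopsAfter (f : E → ℝ) (c tol : ℝ) (w₀ : E) (n : ℕ) : Prop :=
  ∃ w : ℕ → E, w 0 = w₀ ∧
    (∀ k < n, tol ≤ predictedReduction f (w k) ∧ IsGuardedStep f c (w k) (w (k + 1))) ∧
    predictedReduction f (w n) < tol

/-- As `IsGuardedStep`, but a trial step for which the Armijo test holds with equality may be
accepted or rejected. -/
def IsGuardedStepTies (f : E → ℝ) (c : ℝ) (w w' : E) : Prop :=
  ∃ j : ℕ, trialValue f w j ≤ armijoBound f c w j ∧
    (∀ i < j, armijoBound f c w i ≤ trialValue f w i) ∧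
    w' = w + ((1 / 2 : ℝ) ^ j) • newtonDir f w

/-- As `StopsAfter`, but every test (Armijo or stopping) that holds with equality may be decided
either way. -/
def StopsAfterTies (f : E → ℝ) (c tol : ℝ) (w₀ : E) (n : ℕ) : Prop :=
  ∃ w : ℕ → E, w 0 = w₀ ∧
    (∀ k < n, tol ≤ predictedReduction f (w k) ∧ IsGuardedStepTies f c (w k) (w (k + 1))) ∧
    predictedReduction f (w n) ≤ tol

/-- No Armijo test that is carried out in a guarded Newton step from `w` holds with equality. -/
def NoArmijoTie (f : E → ℝ) (c : ℝ) (w : E) : Prop :=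
  ∀ j : ℕ, (∀ i < j, armijoBound f c w i < trialValue f w i) →
    trialValue f w j ≠ armijoBound f c w j

end GuardedNewton

/-! ### The support vector machine objectives -/

/-- `ψ(u) = (u + √(1 + u²)) / 2`. -/
def psi (u : ℝ) : ℝ := (u + Real.sqrt (1 + u ^ 2)) / 2

/-- The soft-margin SVM objective with hinge loss. -/
def softMargin {m N : ℕ} (lam : ℝ) (x : Fin N → EuclideanSpace ℝ (Fin m)) (y : Fin N → ℝ)
    (w : EuclideanSpace ℝ (Fin m)) : ℝ :=
  1 / 2 * lam * ‖w‖ ^ 2 + 1 / (N : ℝ) * ∑ i, max 0 (1 - y i * inner ℝ (x i) w)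

/-- The objective with the hinge loss smoothed at scale `α`. -/
def smoothed {m N : ℕ} (lam : ℝ) (x : Fin N → EuclideanSpace ℝ (Fin m)) (y : Fin N → ℝ)
    (α : ℝ) (w : EuclideanSpace ℝ (Fin m)) : ℝ :=
  1 / 2 * lam * ‖w‖ ^ 2 + 1 / (N : ℝ) * ∑ i, α * psi ((1 - y i * inner ℝ (x i) w) / α)

open Classical in
/-- Indices of the data points that lie on the margin of `w`. -/
def marginSet {m N : ℕ} (x : Fin N → EuclideanSpace ℝ (Fin m)) (y : Fin N → ℝ)
    (w : EuclideanSpace ℝ (Fin m)) : Finset (Fin N) :=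
  Finset.univ.filter fun i => 1 = y i * inner ℝ (x i) w

open Classical in
/-- Indices of the data points that violate the margin of `w`. -/
def violatedSet {m N : ℕ} (x : Fin N → EuclideanSpace ℝ (Fin m)) (y : Fin N → ℝ)
    (w : EuclideanSpace ℝ (Fin m)) : Finset (Fin N) :=
  Finset.univ.filter fun j => y j * inner ℝ (x j) w < 1

/-- The limiting function; it involves only the data points with index in `I` and the
multipliers `θ i`, `i ∈ I`. -/
def limitFun {m N : ℕ} (x : Fin N → EuclideanSpace ℝ (Fin m)) (y : Fin N → ℝ)
    (I : Finset (Fin N)) (θ : Fin N → ℝ) (ω : EuclideanSpace ℝ (Fin m)) : ℝ :=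
  ∑ i ∈ I, (psi (y i * inner ℝ (x i) ω) - θ i * (y i * inner ℝ (x i) ω))

end SmSVM

end

/-!
# Step counts of the guarded Newton method for smoothed support vector machines

*Rescaling.* Put `w = w* - α ω`. The reflection `ψ(u) = ψ(-u) + u` and the equation for `θ` show
that the smoothed objective is `α / N` times
`limitFun + (N λ α / 2) ‖ω‖² + ∑ ψ(-rⱼ / α ± yⱼ⟪xⱼ, ω⟫)` plus a constant, where the sum extends over
the points off the margin and `rⱼ > 0` (`smoothed_eq_ridgeFun`). The guarded Newton method is affine
invariant (`StopsAfter.rescale`), so it may be studied for these functions. They converge to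
`limitFun` together with gradients and Hessians, and the reduction of `α` to `β α` replaces `ω` by
`β⁻¹ ω`.

*Compactness.* All functions of the family are convex, lie above `limitFun`, and have Hessians that
are bounded above and, on sublevel sets of `limitFun`, below. Hence a small predicted reduction
confines `ω` to the unit ball about the minimizer `d`
(`exists_norm_sub_lt_of_predictedReduction_lt`), backtracking takes boundedly many trials, and each
step lowers the function by a fixed amount, which bounds the number of steps
(`NewtonBounds.steps_le`). If `α` tends to `0` along an ultrafilter, numbers of steps and exponents
of step lengths are therefore eventually constant, the iterates converge, and the limit is a run of
the limiting problem, in which strict inequalities may have become equalities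
(`exists_threshold_stepCount`).

*Runs near `β⁻¹ d`.* It remains to compare runs of the limiting problem with tolerance `t = N η`,
started within `O(√t)` of `β⁻¹ d`, with the unperturbed run from `β⁻¹ d`. In the coordinates
`uᵢ = yᵢ⟪xᵢ, ω⟫`, `i ∈ I`, the limiting function is a sum of functions of one variable, and so are
the predicted reduction and both sides of the Armijo test. Since the unperturbed run meets no ties,
its first `k` steps are reproduced by the perturbed run with error `O(√t)`, for every fixed `k`
(`exists_error_bound`). Near `d` the first step length `s < 2 (1 - c)` is always chosen, and the
step map is a contraction with factor close to `1 - s`. As the number of steps tends to infinity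
when `t → 0`, the error is small compared with `√t` by the time at which the predicted reduction is of
order `t`, and the two stopping times are related as claimed (`eventually_coord_stepCount`). For
`c < 1 / 2` full steps are taken, and superlinear convergence takes the run from below `(1 + ε) t`
to below `(1 - ε) t` in one step.
-/

namespace SmSVM

open Filter Topology

set_option linter.unusedSectionVars false

/-! ### The smoothing function of one variable -/

/-- The derivative of `psi`. -/
noncomputable def dpsi (u : ℝ) : ℝ := (1 + u / Real.sqrt (1 + u ^ 2)) / 2

/-- The second derivative of `psi`. -/
noncomputable def ddpsi (u : ℝ) : ℝ := 1 / (2 * Real.sqrt (1 + u ^ 2) ^ 3)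

lemma one_add_sq_pos (u : ℝ) : 0 < 1 + u ^ 2 := by positivity

lemma sqrt_one_add_sq_pos (u : ℝ) : 0 < Real.sqrt (1 + u ^ 2) :=
  Real.sqrt_pos.2 (one_add_sq_pos u)

lemma sq_sqrt_one_add_sq (u : ℝ) : Real.sqrt (1 + u ^ 2) ^ 2 = 1 + u ^ 2 :=
  Real.sq_sqrt (one_add_sq_pos u).le

lemma one_le_sqrt_one_add_sq (u : ℝ) : 1 ≤ Real.sqrt (1 + u ^ 2) :=
  Real.one_le_sqrt.2 (by nlinarith [sq_nonneg u])

lemma abs_lt_sqrt_one_add_sq (u : ℝ) : |u| < Real.sqrt (1 + u ^ 2) :=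
  Real.lt_sqrt_of_sq_lt (by rw [sq_abs]; linarith)

lemma contDiff_sqrt_one_add_sq : ContDiff ℝ 1 fun u : ℝ => Real.sqrt (1 + u ^ 2) :=
  ContDiff.sqrt (by fun_prop) fun u => (one_add_sq_pos u).ne'

lemma contDiff_dpsi : ContDiff ℝ 1 dpsi := by
  unfold dpsi
  exact ((contDiff_const.add (contDiff_id.div contDiff_sqrt_one_add_sq
    fun u => (sqrt_one_add_sq_pos u).ne'))).div_const 2

lemma contDiff_ddpsi : ContDiff ℝ 1 ddpsi := by
  unfold ddpsi
  exact contDiff_const.div (contDiff_const.mul (contDiff_sqrt_one_add_sq.pow 3))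
    fun u => by have := sqrt_one_add_sq_pos u; positivity

@[fun_prop] lemma continuous_psi : Continuous psi := by
  unfold psi; fun_prop

@[fun_prop] lemma continuous_dpsi : Continuous dpsi := contDiff_dpsi.continuous

@[fun_prop] lemma continuous_ddpsi : Continuous ddpsi := contDiff_ddpsi.continuous

lemma hasDerivAt_sqrt_one_add_sq (u : ℝ) :
    HasDerivAt (fun u : ℝ => Real.sqrt (1 + u ^ 2)) (u / Real.sqrt (1 + u ^ 2)) u := by
  have h : HasDerivAt (fun u : ℝ => 1 + u ^ 2) (2 * u) u := by
    simpa using (hasDerivAt_pow 2 u).const_add 1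
  convert h.sqrt (one_add_sq_pos u).ne' using 1
  field_simp

lemma hasDerivAt_psi (u : ℝ) : HasDerivAt psi (dpsi u) u :=
  ((hasDerivAt_id u).add (hasDerivAt_sqrt_one_add_sq u)).div_const 2

lemma hasDerivAt_dpsi (u : ℝ) : HasDerivAt dpsi (ddpsi u) u := by
  have h := sqrt_one_add_sq_pos u
  have h2 := sq_sqrt_one_add_sq u
  refine ((((hasDerivAt_id u).div (hasDerivAt_sqrt_one_add_sq u) h.ne').const_add 1).div_const
    2).congr_deriv ?_
  unfold ddpsi
  simp only [id]
  field_simp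
  linarith

lemma psi_neg (u : ℝ) : psi (-u) = psi u - u := by
  unfold psi; rw [neg_sq]; ring

lemma psi_pos (u : ℝ) : 0 < psi u := by
  have := abs_lt_sqrt_one_add_sq u
  have := neg_abs_le u
  unfold psi; linarith

lemma ddpsi_pos (u : ℝ) : 0 < ddpsi u := by
  have := sqrt_one_add_sq_pos u
  unfold ddpsi; positivity

lemma ddpsi_le (u : ℝ) : ddpsi u ≤ 1 / 2 := by
  have := one_le_pow₀ (one_le_sqrt_one_add_sq u) (n := 3)
  unfold ddpsi
  rw [div_le_div_iff₀ (by positivity) (by norm_num)]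
  linarith

lemma ddpsi_le_ddpsi_of_abs_le {u r : ℝ} (h : |u| ≤ r) : ddpsi r ≤ ddpsi u := by
  have := sqrt_one_add_sq_pos u
  have h2 : u ^ 2 ≤ r ^ 2 := sq_le_sq' (by linarith [neg_abs_le u]) (by linarith [le_abs_self u])
  unfold ddpsi
  gcongr

/-- Linear growth on both sides, for `0 ≤ θ ≤ 1`; this is what makes the limiting function
coercive. -/
lemma mul_abs_le_psi_sub {θ t : ℝ} (h0 : t ≤ θ) (h1 : t ≤ 1 - θ) (u : ℝ) :
    t * |u| ≤ psi u - θ * u := by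
  have := abs_lt_sqrt_one_add_sq u
  unfold psi
  rcases le_total 0 u with h | h
  · rw [abs_of_nonneg h] at *; nlinarith
  · rw [abs_of_nonpos h] at *; nlinarith

/-- The quotient `(ψ(v) - ψ(a) - ψ'(a)(v - a)) / (v - a)²` in a form without singularity
at `v = a`. -/
noncomputable def psiQuot (a v : ℝ) : ℝ :=
  (1 + Real.sqrt (1 + v ^ 2) * Real.sqrt (1 + a ^ 2) - a * v) /
    (2 * Real.sqrt (1 + a ^ 2) * (Real.sqrt (1 + v ^ 2) + Real.sqrt (1 + a ^ 2)) ^ 2)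

lemma psi_sub_eq (a v : ℝ) : psi v - psi a - dpsi a * (v - a) = psiQuot a v * (v - a) ^ 2 := by
  have hA := sqrt_one_add_sq_pos v
  have hD := sqrt_one_add_sq_pos a
  have hA2 := sq_sqrt_one_add_sq v
  have hD2 := sq_sqrt_one_add_sq a
  unfold psi dpsi psiQuot
  set A := Real.sqrt (1 + v ^ 2)
  set D := Real.sqrt (1 + a ^ 2)
  have hAD : A + D ≠ 0 := by positivity
  field_simp
  have e1 : (A - D) * (A + D) = (v - a) * (v + a) := by linear_combination hA2 - hD2
  have e2 : D * (A + D) - a * (v + a) = 1 + A * D - a * v := by linear_combination hD2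
  linear_combination (D * (A + D)) * e1 - (v - a) * (a * e1) + (v - a) ^ 2 * e2

lemma mul_lt_sqrt_mul_sqrt (a v : ℝ) :
    a * v < Real.sqrt (1 + v ^ 2) * Real.sqrt (1 + a ^ 2) := by
  calc a * v ≤ |a * v| := le_abs_self _
    _ = |v| * |a| := by rw [abs_mul, mul_comm]
    _ < _ := mul_lt_mul'' (abs_lt_sqrt_one_add_sq v) (abs_lt_sqrt_one_add_sq a)
      (abs_nonneg _) (abs_nonneg _)

lemma psiQuot_pos (a v : ℝ) : 0 < psiQuot a v := by
  have hA := sqrt_one_add_sq_pos v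
  have hD := sqrt_one_add_sq_pos a
  have := mul_lt_sqrt_mul_sqrt a v
  unfold psiQuot
  apply div_pos _ (by positivity)
  linarith

lemma psiQuot_le (a v : ℝ) : psiQuot a v ≤ 1 / 4 := by
  have hA := sqrt_one_add_sq_pos v
  have hD := one_le_sqrt_one_add_sq a
  have hA2 := sq_sqrt_one_add_sq v
  have hD2 := sq_sqrt_one_add_sq a
  unfold psiQuot
  set A := Real.sqrt (1 + v ^ 2)
  set D := Real.sqrt (1 + a ^ 2)
  rw [div_le_div_iff₀ (by positivity) (by norm_num)]
  nlinarith [sq_nonneg (a + v), mul_le_mul_of_nonneg_right hD (sq_nonneg (A + D))]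

lemma continuous_psiQuot (a : ℝ) : Continuous (psiQuot a) := by
  unfold psiQuot
  refine Continuous.div (by fun_prop) (by fun_prop) fun v => ?_
  have hA := sqrt_one_add_sq_pos v
  have hD := sqrt_one_add_sq_pos a
  positivity

lemma psiQuot_self (a : ℝ) : psiQuot a a = ddpsi a / 2 := by
  have hD := sqrt_one_add_sq_pos a
  have hD2 := sq_sqrt_one_add_sq a
  unfold psiQuot ddpsi
  set D := Real.sqrt (1 + a ^ 2)
  field_simp
  linear_combination 2 * hD2

lemma psi_le_quadratic (a v : ℝ) : psi v ≤ psi a + dpsi a * (v - a) + 1 / 4 * (v - a) ^ 2 := by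
  have := psi_sub_eq a v
  have := mul_le_mul_of_nonneg_right (psiQuot_le a v) (sq_nonneg (v - a))
  linarith

lemma dpsi_sub_mul_sub (a v : ℝ) :
    (dpsi v - dpsi a) * (v - a) = (psiQuot a v + psiQuot v a) * (v - a) ^ 2 := by
  linear_combination psi_sub_eq a v + psi_sub_eq v a

lemma psiQuot_mul_sq_le (a v : ℝ) :
    psiQuot a v * (v - a) ^ 2 ≤ (dpsi v - dpsi a) * (v - a) := by
  rw [dpsi_sub_mul_sub]
  gcongr
  linarith [psiQuot_pos v a]

lemma dpsi_sub_mul_sub_nonneg (a v : ℝ) : 0 ≤ (dpsi v - dpsi a) * (v - a) :=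
  (mul_nonneg (psiQuot_pos a v).le (sq_nonneg _)).trans (psiQuot_mul_sq_le a v)

lemma monotone_dpsi : Monotone dpsi :=
  monotone_of_hasDerivAt_nonneg hasDerivAt_dpsi fun u => (ddpsi_pos u).le

lemma dpsi_nonneg (u : ℝ) : 0 ≤ dpsi u := by
  have h := sqrt_one_add_sq_pos u
  have h1 := abs_lt_sqrt_one_add_sq u
  have : -1 ≤ u / Real.sqrt (1 + u ^ 2) := by
    rw [le_div_iff₀ h]; linarith [neg_abs_le u]
  unfold dpsi; linarith

lemma monotone_psi : Monotone psi :=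
  monotone_of_hasDerivAt_nonneg hasDerivAt_psi dpsi_nonneg

lemma tendsto_sqrt_one_add_sq_atBot :
    Tendsto (fun u : ℝ => Real.sqrt (1 + u ^ 2)) atBot atTop := by
  refine tendsto_atTop_mono (fun u => ?_) tendsto_neg_atBot_atTop
  linarith [neg_abs_le u, abs_lt_sqrt_one_add_sq u]

lemma tendsto_psi_atBot : Tendsto psi atBot (𝓝 0) := by
  refine squeeze_zero' (Eventually.of_forall fun u => (psi_pos u).le) ?_
    tendsto_sqrt_one_add_sq_atBot.inv_tendsto_atTop
  filter_upwards [eventually_le_atBot (0 : ℝ)] with u hu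
  have h := sqrt_one_add_sq_pos u
  have h2 := sq_sqrt_one_add_sq u
  simp only [Pi.inv_apply]
  rw [← one_div, le_div_iff₀ h]
  unfold psi
  nlinarith [abs_lt_sqrt_one_add_sq u, neg_abs_le u]

lemma tendsto_ddpsi_atBot : Tendsto ddpsi atBot (𝓝 0) := by
  refine squeeze_zero (fun u => (ddpsi_pos u).le) (fun u => ?_)
    tendsto_sqrt_one_add_sq_atBot.inv_tendsto_atTop
  have h := one_le_sqrt_one_add_sq u
  simp only [Pi.inv_apply]
  rw [← one_div]
  unfold ddpsi
  apply one_div_le_one_div_of_le (by linarith)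
  nlinarith [one_le_pow₀ h (n := 2)]

/-- On the left, `ψ' = ψ / √(1 + u²) ≤ ψ`. -/
lemma tendsto_dpsi_atBot : Tendsto dpsi atBot (𝓝 0) := by
  refine squeeze_zero dpsi_nonneg (fun u => ?_) tendsto_psi_atBot
  have h := one_le_sqrt_one_add_sq u
  have h0 := sqrt_one_add_sq_pos u
  have h1 : dpsi u * Real.sqrt (1 + u ^ 2) = psi u := by
    unfold dpsi psi
    field_simp
    ring
  nlinarith [dpsi_nonneg u]

lemma exists_dpsi_eq {θ : ℝ} (h0 : 0 < θ) (h1 : θ < 1) : ∃ d, dpsi d = θ := by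
  have hp : 0 < θ * (1 - θ) := mul_pos h0 (by linarith)
  set r := Real.sqrt (θ * (1 - θ)) with hr
  have hr0 : 0 < r := Real.sqrt_pos.2 hp
  have hr2 : r ^ 2 = θ * (1 - θ) := Real.sq_sqrt hp.le
  refine ⟨(2 * θ - 1) / (2 * r), ?_⟩
  have h : 1 + ((2 * θ - 1) / (2 * r)) ^ 2 = (1 / (2 * r)) ^ 2 := by
    field_simp
    linear_combination 4 * hr2
  unfold dpsi
  rw [h, Real.sqrt_sq (by positivity)]
  field_simp
  ring

/-- The gap of `ψ'` away from a point grows at least like the truncated distance. -/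
lemma exists_mul_min_le_abs_dpsi_sub (a : ℝ) :
    ∃ c > 0, ∀ v, c * min 1 |v - a| ≤ |dpsi v - dpsi a| := by
  obtain ⟨z, -, hz⟩ := (isCompact_Icc (a := a - 1) (b := a + 1)).exists_isMinOn
    ⟨a, by simp⟩ (continuous_psiQuot a).continuousOn
  have key : ∀ v, |v - a| ≤ 1 → psiQuot a z * |v - a| ≤ |dpsi v - dpsi a| := by
    intro v hv
    have h1 : psiQuot a z ≤ psiQuot a v := hz (by
      rw [abs_le] at hv; constructor <;> linarith [hv.1, hv.2])
    rcases (abs_nonneg (v - a)).eq_or_lt with h0 | h0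
    · rw [← h0]; simp
    · refine le_of_mul_le_mul_right ?_ h0
      have h2 := psiQuot_mul_sq_le a v
      rw [← abs_mul, abs_of_nonneg (dpsi_sub_mul_sub_nonneg a v)]
      have h3 : |v - a| * |v - a| = (v - a) ^ 2 := by rw [← sq, sq_abs]
      rw [mul_assoc, h3]
      exact (mul_le_mul_of_nonneg_right h1 (sq_nonneg _)).trans h2
  refine ⟨psiQuot a z, psiQuot_pos a z, fun v => ?_⟩
  rcases le_total |v - a| 1 with h | h
  · rw [min_eq_right h]; exact key v h
  · rw [min_eq_left h]
    rcases le_abs'.1 h with h' | h'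
    · have h1 := key (a - 1) (by simp)
      have h2 := monotone_dpsi (show v ≤ a - 1 by linarith)
      have h3 := monotone_dpsi (show a - 1 ≤ a by linarith)
      rw [show |a - 1 - a| = 1 by simp, abs_of_nonpos (by linarith)] at h1
      rw [abs_of_nonpos (by linarith)]
      linarith
    · have h1 := key (a + 1) (by simp)
      have h2 := monotone_dpsi (show a + 1 ≤ v by linarith)
      have h3 := monotone_dpsi (show a ≤ a + 1 by linarith)
      rw [show |a + 1 - a| = 1 by simp, abs_of_nonneg (by linarith)] at h1
      rw [abs_of_nonneg (by linarith)]
      linarith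

/-- The negative `(ψ'(u) - θ) / ψ''(u)` of the Newton direction of `u ↦ ψ(u) - θ u`. -/
noncomputable def scalarNewton (θ u : ℝ) : ℝ := (dpsi u - θ) / ddpsi u

lemma contDiff_scalarNewton (θ : ℝ) : ContDiff ℝ 1 (scalarNewton θ) :=
  (contDiff_dpsi.sub contDiff_const).div contDiff_ddpsi fun u => (ddpsi_pos u).ne'

@[fun_prop] lemma continuous_scalarNewton (θ : ℝ) : Continuous (scalarNewton θ) :=
  (contDiff_scalarNewton θ).continuous

lemma hasDerivAt_scalarNewton {θ a : ℝ} (ha : dpsi a = θ) :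
    HasDerivAt (scalarNewton θ) 1 a := by
  have h := (hasDerivAt_dpsi a).sub_const θ
  have h2 := ((contDiff_ddpsi.differentiable one_ne_zero) a).hasDerivAt
  have h0 := (ddpsi_pos a).ne'
  refine (h.div h2 h0).congr_deriv ?_
  rw [ha]; field_simp; ring

/-- Contribution of one coordinate to `F(w + sδ) - F(w) - c s δᵀ∇F(w)`: the Armijo test is passed
when the sum of these numbers over the coordinates is at most `0`. -/
noncomputable def scalarGap (θ c s u : ℝ) : ℝ :=
  (psi (u - s * scalarNewton θ u) - θ * (u - s * scalarNewton θ u)) - (psi u - θ * u)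
    + c * s * (scalarNewton θ u * (dpsi u - θ))

@[fun_prop] lemma continuous_scalarGap (θ c s : ℝ) : Continuous (scalarGap θ c s) := by
  unfold scalarGap; fun_prop

lemma scalarNewton_self {θ a : ℝ} (ha : dpsi a = θ) : scalarNewton θ a = 0 := by
  simp [scalarNewton, ha]

lemma scalarGap_self {θ a : ℝ} (ha : dpsi a = θ) (c s : ℝ) : scalarGap θ c s a = 0 := by
  simp [scalarGap, scalarNewton_self ha]

/-- Second-order expansion of the Armijo gap at the minimizer. -/
lemma tendsto_scalarGap_div {θ a : ℝ} (ha : dpsi a = θ) (c s : ℝ) :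
    Tendsto (fun u => scalarGap θ c s u / (u - a) ^ 2) (𝓝[≠] a)
      (𝓝 (psiQuot a a * (s * (s - 2 + 2 * c)))) := by
  have hN : Tendsto (fun u => scalarNewton θ u / (u - a)) (𝓝[≠] a) (𝓝 1) := by
    have := hasDerivAt_iff_tendsto_slope.1 (hasDerivAt_scalarNewton ha)
    refine this.congr fun u => ?_
    rw [slope_def_field, scalarNewton_self ha, sub_zero]
  have hD : Tendsto (fun u => (dpsi u - θ) / (u - a)) (𝓝[≠] a) (𝓝 (ddpsi a)) := by
    have := hasDerivAt_iff_tendsto_slope.1 (hasDerivAt_dpsi a)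
    refine this.congr fun u => ?_
    rw [slope_def_field, ha]
  have hle : 𝓝[≠] a ≤ 𝓝 a := nhdsWithin_le_nhds
  have hQ0 : Tendsto (psiQuot a) (𝓝[≠] a) (𝓝 (psiQuot a a)) :=
    ((continuous_psiQuot a).tendsto a).mono_left hle
  have hQ : Tendsto (fun u => psiQuot a (u - s * scalarNewton θ u)) (𝓝[≠] a)
      (𝓝 (psiQuot a a)) := by
    have hc : Continuous fun u => psiQuot a (u - s * scalarNewton θ u) :=
      (continuous_psiQuot a).comp (by fun_prop)
    have := hc.tendsto a
    rw [scalarNewton_self ha, mul_zero, sub_zero] at this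
    exact this.mono_left hle
  have hlim := ((hQ.mul ((hN.const_mul s).const_sub 1 |>.pow 2)).sub hQ0).add
    ((hN.mul hD).const_mul (c * s))
  have hval : psiQuot a a * (1 - s * 1) ^ 2 - psiQuot a a + c * s * (1 * ddpsi a)
      = psiQuot a a * (s * (s - 2 + 2 * c)) := by
    have := psiQuot_self a
    linear_combination (-2 * c * s) * this
  rw [hval] at hlim
  refine hlim.congr' ?_
  filter_upwards [self_mem_nhdsWithin] with u hu
  have hne : u - a ≠ 0 := sub_ne_zero.2 hu
  have h1 := psi_sub_eq a (u - s * scalarNewton θ u)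
  have h2 := psi_sub_eq a u
  rw [ha] at h1 h2
  have h3 : scalarGap θ c s u = psiQuot a (u - s * scalarNewton θ u) *
      (u - s * scalarNewton θ u - a) ^ 2 - psiQuot a u * (u - a) ^ 2
      + c * s * (scalarNewton θ u * (dpsi u - θ)) := by
    unfold scalarGap
    linear_combination h1 - h2
  rw [h3]
  field_simp
  ring

/-- Step lengths `s < 2(1 - c)` pass the Armijo test near the minimizer. -/
lemma eventually_scalarGap_neg {θ a c s : ℝ} (ha : dpsi a = θ) (hs : 0 < s)
    (h : s < 2 * (1 - c)) : ∀ᶠ u in 𝓝 a, u ≠ a → scalarGap θ c s u < 0 := by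
  have h1 : psiQuot a a * (s * (s - 2 + 2 * c)) < 0 :=
    mul_neg_of_pos_of_neg (psiQuot_pos a a) (mul_neg_of_pos_of_neg hs (by linarith))
  have := (tendsto_scalarGap_div ha c s).eventually_lt_const h1
  rw [eventually_nhdsWithin_iff] at this
  filter_upwards [this] with u hu hne
  have h2 : 0 < (u - a) ^ 2 := by have := sub_ne_zero.2 hne; positivity
  by_contra h3
  exact absurd (hu hne) (not_lt.2 (div_nonneg (not_lt.1 h3) h2.le))

/-- Step lengths `s > 2(1 - c)` fail the Armijo test near the minimizer. -/
lemma eventually_scalarGap_pos {θ a c s : ℝ} (ha : dpsi a = θ) (hs : 0 < s)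
    (h : 2 * (1 - c) < s) : ∀ᶠ u in 𝓝 a, u ≠ a → 0 < scalarGap θ c s u := by
  have h1 : 0 < psiQuot a a * (s * (s - 2 + 2 * c)) :=
    mul_pos (psiQuot_pos a a) (mul_pos hs (by linarith))
  have := (tendsto_scalarGap_div ha c s).eventually_const_lt h1
  rw [eventually_nhdsWithin_iff] at this
  filter_upwards [this] with u hu hne
  have h2 : 0 < (u - a) ^ 2 := by have := sub_ne_zero.2 hne; positivity
  by_contra h3
  exact absurd (hu hne) (not_lt.2 (div_nonpos_of_nonpos_of_nonneg (not_lt.1 h3) h2.le))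

/-- A signed square root of the contribution of one coordinate to the predicted reduction. The sign
is that of `ψ'(u) - θ`, which makes it continuously differentiable at the minimizer. -/
noncomputable def scalarResidual (θ u : ℝ) : ℝ := (dpsi u - θ) / Real.sqrt (ddpsi u)

lemma contDiff_scalarResidual (θ : ℝ) : ContDiff ℝ 1 (scalarResidual θ) :=
  (contDiff_dpsi.sub contDiff_const).div (contDiff_ddpsi.sqrt fun u => (ddpsi_pos u).ne')
    fun u => (Real.sqrt_pos.2 (ddpsi_pos u)).ne'

@[fun_prop] lemma continuous_scalarResidual (θ : ℝ) : Continuous (scalarResidual θ) :=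
  (contDiff_scalarResidual θ).continuous

lemma scalarResidual_sq (θ u : ℝ) :
    scalarResidual θ u ^ 2 = scalarNewton θ u * (dpsi u - θ) := by
  unfold scalarResidual scalarNewton
  rw [div_pow, Real.sq_sqrt (ddpsi_pos u).le]
  ring

/-- A continuously differentiable function is Lipschitz near each point, with any constant larger
than the absolute value of its derivative there. -/
lemma eventually_abs_sub_le {f : ℝ → ℝ} (hf : ContDiff ℝ 1 f) {a f' C : ℝ}
    (hd : HasDerivAt f f' a) (hC : |f'| < C) :
    ∀ᶠ r in 𝓝[>] (0 : ℝ), ∀ u v, |u - a| ≤ r → |v - a| ≤ r → |f u - f v| ≤ C * |u - v| := by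
  have hs : HasStrictDerivAt f f' a := by
    have := hf.contDiffAt.hasStrictDerivAt (x := a) one_ne_zero
    rwa [hd.deriv] at this
  have := hs.hasStrictFDerivAt.isLittleO.def (sub_pos.2 hC)
  rw [Metric.eventually_nhds_iff] at this
  obtain ⟨ρ, hρ, H⟩ := this
  filter_upwards [Ioo_mem_nhdsGT hρ] with r hr u v hu hv
  have := H (y := (u, v)) (by
    rw [Prod.dist_eq, Real.dist_eq, Real.dist_eq]
    exact max_lt (hu.trans_lt hr.2) (hv.trans_lt hr.2))
  simp only [Real.norm_eq_abs, ContinuousLinearMap.toSpanSingleton_apply, smul_eq_mul] at this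
  calc |f u - f v| = |(f u - f v - (u - v) * f') + (u - v) * f'| := by ring_nf
    _ ≤ |f u - f v - (u - v) * f'| + |(u - v) * f'| := abs_add_le _ _
    _ ≤ (C - |f'|) * |u - v| + |u - v| * |f'| := by rw [abs_mul]; gcongr
    _ = _ := by ring

/-! ### The guarded Newton method for functions with positive definite Hessian -/

section Newton

variable {E : Type*} [NormedAddCommGroup E] [InnerProductSpace ℝ E] [CompleteSpace E]
  [FiniteDimensional ℝ E]

/-- `F` has gradient `g` and Hessian `H`, and the Hessian is positive definite everywhere. -/
structure HasNewtonData (F : E → ℝ) (g : E → E) (H : E → E →L[ℝ] E) : Prop where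
  grad : ∀ w, HasGradientAt F (g w) w
  hess : ∀ w, HasFDerivAt g (H w) w
  pos : ∀ w v, v ≠ 0 → 0 < inner ℝ (H w v) v

lemma isInvertible_of_inner_pos {A : E →L[ℝ] E} (h : ∀ v, v ≠ 0 → 0 < inner ℝ (A v) v) :
    A.IsInvertible := by
  have hinj : Function.Injective (A : E →ₗ[ℝ] E) := by
    rw [injective_iff_map_eq_zero]
    intro v hv
    by_contra hne
    have := h v hne
    rw [show A v = 0 from hv, inner_zero_left] at this
    exact lt_irrefl _ this
  exact ⟨(LinearEquiv.ofInjectiveEndo (A : E →ₗ[ℝ] E) hinj).toContinuousLinearEquiv, by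
    ext v; rfl⟩

namespace HasNewtonData

variable {F : E → ℝ} {g : E → E} {H : E → E →L[ℝ] E}

lemma gradient_eq (h : HasNewtonData F g H) : gradient F = g :=
  funext fun w => (h.grad w).gradient

lemma hess_newtonDir (h : HasNewtonData F g H) (w : E) : H w (newtonDir F w) = -g w := by
  rw [newtonDir, h.gradient_eq, (h.hess w).fderiv, map_neg,
    (isInvertible_of_inner_pos (h.pos w)).self_apply_inverse]

lemma newtonDir_eq (h : HasNewtonData F g H) {w δ : E} (hδ : H w δ = -g w) :
    newtonDir F w = δ := by
  by_contra hne
  have := h.pos w _ (sub_ne_zero.2 hne)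
  rw [map_sub, h.hess_newtonDir, hδ, sub_self, inner_zero_left] at this
  exact lt_irrefl _ this

lemma inner_newtonDir (h : HasNewtonData F g H) (w : E) :
    inner ℝ (newtonDir F w) (gradient F w) =
      -inner ℝ (H w (newtonDir F w)) (newtonDir F w) := by
  rw [h.hess_newtonDir, h.gradient_eq, inner_neg_left, neg_neg, real_inner_comm]

lemma inner_hess_nonneg (h : HasNewtonData F g H) (w v : E) : 0 ≤ inner ℝ (H w v) v := by
  by_cases hv : v = 0
  · simp [hv]
  · exact (h.pos w v hv).le

lemma predictedReduction_eq (h : HasNewtonData F g H) (w : E) :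
    predictedReduction F w = inner ℝ (H w (newtonDir F w)) (newtonDir F w) := by
  rw [predictedReduction, h.inner_newtonDir, abs_neg, abs_of_nonneg (h.inner_hess_nonneg _ _)]

lemma inner_newtonDir_gradient (h : HasNewtonData F g H) (w : E) :
    inner ℝ (newtonDir F w) (gradient F w) = -predictedReduction F w := by
  rw [h.inner_newtonDir, h.predictedReduction_eq]

/-- The predicted reduction bounds the slope of `F` in every direction. The estimate expands the
Hessian form at `δ + t v`, with `δ` the Newton direction and `t` at its optimal value. -/
lemma le_predictedReduction (h : HasNewtonData F g H) {w v : E} {a L : ℝ} (ha : 0 ≤ a)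
    (hL : 0 < L) (hv : v ≠ 0) (hg : a * ‖v‖ ≤ inner ℝ (g w) v)
    (hHv : inner ℝ (H w v) v ≤ L * ‖v‖ ^ 2)
    (hsymm : ∀ u v, inner ℝ (H w u) v = inner ℝ u (H w v)) :
    a ^ 2 / L ≤ predictedReduction F w := by
  have hv0 : 0 < ‖v‖ := norm_pos_iff.2 hv
  set δ := newtonDir F w with hδ
  set t := a / (L * ‖v‖) with ht
  have h0 := h.inner_hess_nonneg w (δ + t • v)
  have h1 : inner ℝ (H w (δ + t • v)) (δ + t • v) =
      predictedReduction F w - 2 * t * inner ℝ (g w) v + t ^ 2 * inner ℝ (H w v) v := by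
    rw [h.predictedReduction_eq, ← hδ]
    simp only [map_add, map_smul, inner_add_left, inner_add_right, real_inner_smul_left,
      real_inner_smul_right]
    rw [hsymm v δ, show H w δ = -g w from h.hess_newtonDir w, inner_neg_left, inner_neg_left,
      inner_neg_right, real_inner_comm v (g w)]
    ring
  have ht0 : 0 ≤ t := by positivity
  have h2 : 2 * t * (a * ‖v‖) ≤ 2 * t * inner ℝ (g w) v := by gcongr
  have h3 : t ^ 2 * inner ℝ (H w v) v ≤ t ^ 2 * (L * ‖v‖ ^ 2) := by gcongr
  have h4 : 2 * t * (a * ‖v‖) - t ^ 2 * (L * ‖v‖ ^ 2) = a ^ 2 / L := by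
    rw [ht]; field_simp; ring
  linarith

end HasNewtonData

/-- Newton data together with what a uniform bound for the number of guarded steps needs:
nonnegativity, curvature at least `μ` on the sublevel set at height `C`, and a quadratic upper bound
with constant `L`. -/
structure NewtonBounds (F : E → ℝ) (g : E → E) (H : E → E →L[ℝ] E) (C μ L : ℝ) : Prop
    extends HasNewtonData F g H where
  nonneg : ∀ w, 0 ≤ F w
  descent : ∀ w v, F (w + v) ≤ F w + inner ℝ (g w) v + L / 2 * ‖v‖ ^ 2
  curv : ∀ w v, F w ≤ C → μ * ‖v‖ ^ 2 ≤ inner ℝ (H w v) v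

lemma predictedReduction_nonneg (F : E → ℝ) (w : E) : 0 ≤ predictedReduction F w := abs_nonneg _

lemma IsGuardedStep.ties {F : E → ℝ} {c : ℝ} {w w' : E} (h : IsGuardedStep F c w w') :
    IsGuardedStepTies F c w w' := by
  obtain ⟨j, h1, h2, h3⟩ := h
  exact ⟨j, h1, fun i hi => (h2 i hi).le, h3⟩

namespace NewtonBounds

variable {F : E → ℝ} {g : E → E} {H : E → E →L[ℝ] E} {C μ L c : ℝ} {J : ℕ}

lemma armijoBound_eq (h : NewtonBounds F g H C μ L) (w : E) (j : ℕ) :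
    armijoBound F c w j = F w - c * (1 / 2) ^ j * predictedReduction F w := by
  rw [armijoBound, h.inner_newtonDir_gradient]; ring

lemma trialValue_le (h : NewtonBounds F g H C μ L) (hμ : 0 < μ) (hL : 0 ≤ L) {w : E}
    (hw : F w ≤ C) (j : ℕ) :
    trialValue F w j ≤ F w - (1 / 2) ^ j * predictedReduction F w
      + (1 / 2) ^ j * ((1 / 2) ^ j * L / (2 * μ)) * predictedReduction F w := by
  set s : ℝ := (1 / 2) ^ j with hs
  have h1 := h.descent w (s • newtonDir F w)
  have h2 := h.curv w (newtonDir F w) hw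
  rw [← h.predictedReduction_eq] at h2
  have h3 := h.inner_newtonDir_gradient w
  rw [h.gradient_eq, real_inner_comm] at h3
  rw [real_inner_smul_right, h3, norm_smul, mul_pow, Real.norm_eq_abs, sq_abs] at h1
  have h4 : L / 2 * (s ^ 2 * ‖newtonDir F w‖ ^ 2)
      ≤ s * (s * L / (2 * μ)) * predictedReduction F w := by
    have : s * (s * L / (2 * μ)) * (μ * ‖newtonDir F w‖ ^ 2)
      = L / 2 * (s ^ 2 * ‖newtonDir F w‖ ^ 2) := by field_simp
    rw [← this]
    gcongr
  rw [trialValue]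
  linarith

lemma trialValue_lt_armijoBound (h : NewtonBounds F g H C μ L) (hμ : 0 < μ) (hL : 0 ≤ L) {w : E}
    (hw : F w ≤ C) (hJ : (1 / 2) ^ J * L / (2 * μ) < 1 - c) (hΛ : 0 < predictedReduction F w) :
    trialValue F w J < armijoBound F c w J := by
  have h1 := h.trialValue_le hμ hL hw J
  have h2 : (1 / 2 : ℝ) ^ J * ((1 / 2) ^ J * L / (2 * μ)) * predictedReduction F w
    < (1 / 2) ^ J * (1 - c) * predictedReduction F w := by gcongr
  rw [h.armijoBound_eq]
  linarith

lemma exists_isGuardedStep (h : NewtonBounds F g H C μ L) (hμ : 0 < μ) (hL : 0 ≤ L) {w : E}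
    (hw : F w ≤ C) (hJ : (1 / 2) ^ J * L / (2 * μ) < 1 - c) :
    ∃ w', IsGuardedStep F c w w' := by
  classical
  have hex : ∃ j, trialValue F w j ≤ armijoBound F c w j := by
    rcases (predictedReduction_nonneg F w).eq_or_lt with h0 | h0
    · refine ⟨J, ?_⟩
      have h1 := h.trialValue_le hμ hL hw J
      rw [h.armijoBound_eq]
      rw [← h0] at h1 ⊢
      linarith
    · exact ⟨J, (h.trialValue_lt_armijoBound hμ hL hw hJ h0).le⟩
  exact ⟨_, Nat.find hex, Nat.find_spec hex, fun i hi => not_le.1 (Nat.find_min hex hi), rfl⟩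

/-- The step length of a guarded step away from the minimizer is bounded below. -/
lemma exponent_le (h : NewtonBounds F g H C μ L) (hμ : 0 < μ) (hL : 0 ≤ L) {w : E}
    (hw : F w ≤ C) (hJ : (1 / 2) ^ J * L / (2 * μ) < 1 - c) (hΛ : 0 < predictedReduction F w)
    {j : ℕ} (hj : ∀ i < j, armijoBound F c w i ≤ trialValue F w i) : j ≤ J := by
  by_contra hlt
  exact absurd (h.trialValue_lt_armijoBound hμ hL hw hJ hΛ) (not_lt.2 (hj J (not_le.1 hlt)))

lemma apply_le_of_step (h : NewtonBounds F g H C μ L) (hc : 0 < c) {w w' : E}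
    (hw' : IsGuardedStepTies F c w w') : F w' ≤ F w := by
  obtain ⟨j, h1, -, rfl⟩ := hw'
  rw [h.armijoBound_eq] at h1
  have := predictedReduction_nonneg F w
  have h2 : 0 ≤ c * (1 / 2) ^ j * predictedReduction F w := by positivity
  rw [trialValue] at h1
  linarith

lemma apply_le_sub_of_step (h : NewtonBounds F g H C μ L) (hμ : 0 < μ) (hL : 0 ≤ L)
    (hc : 0 < c) (hJ : (1 / 2) ^ J * L / (2 * μ) < 1 - c) {tol : ℝ} (htol : 0 < tol) {w w' : E}
    (hw : F w ≤ C) (hΛ : tol ≤ predictedReduction F w)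
    (hw' : IsGuardedStepTies F c w w') : F w' ≤ F w - c * (1 / 2) ^ J * tol := by
  obtain ⟨j, h1, h2, rfl⟩ := hw'
  have hj := h.exponent_le hμ hL hw hJ (htol.trans_le hΛ) h2
  rw [h.armijoBound_eq] at h1
  have h3 : (1 / 2 : ℝ) ^ J ≤ (1 / 2) ^ j :=
    pow_le_pow_of_le_one (by norm_num) (by norm_num) hj
  have h4 : c * (1 / 2 : ℝ) ^ J * tol ≤ c * (1 / 2) ^ j * predictedReduction F w := by gcongr
  rw [trialValue] at h1
  linarith

lemma apply_le_along (h : NewtonBounds F g H C μ L) (hμ : 0 < μ) (hL : 0 ≤ L)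
    (hc : 0 < c) (hJ : (1 / 2) ^ J * L / (2 * μ) < 1 - c) {tol : ℝ} (htol : 0 < tol)
    {w : ℕ → E} {n : ℕ} (hw : F (w 0) ≤ C)
    (hstep : ∀ k < n, tol ≤ predictedReduction F (w k) ∧ IsGuardedStepTies F c (w k) (w (k + 1)))
    {k : ℕ} (hk : k ≤ n) : F (w k) ≤ F (w 0) - k * (c * (1 / 2) ^ J * tol) := by
  induction k with
  | zero => simp
  | succ k ih =>
    have h1 := ih (by omega)
    have h0 : 0 ≤ k * (c * (1 / 2 : ℝ) ^ J * tol) := by positivity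
    have h2 := h.apply_le_sub_of_step hμ hL hc hJ htol (by linarith) (hstep k (by omega)).1
      (hstep k (by omega)).2
    push_cast
    linarith

/-- Uniform bound for the number of guarded steps: each of them decreases `F` by a fixed amount. -/
lemma steps_le (h : NewtonBounds F g H C μ L) (hμ : 0 < μ) (hL : 0 ≤ L)
    (hc : 0 < c) (hJ : (1 / 2) ^ J * L / (2 * μ) < 1 - c) {tol : ℝ} (htol : 0 < tol)
    {w : ℕ → E} {n : ℕ} (hw : F (w 0) ≤ C)
    (hstep : ∀ k < n, tol ≤ predictedReduction F (w k) ∧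
      IsGuardedStepTies F c (w k) (w (k + 1))) :
    n ≤ ⌊C / (c * (1 / 2) ^ J * tol)⌋₊ := by
  apply Nat.le_floor
  rw [le_div_iff₀ (by positivity)]
  have := h.apply_le_along hμ hL hc hJ htol hw hstep le_rfl
  have := h.nonneg (w n)
  linarith

lemma exists_stopsAfter (h : NewtonBounds F g H C μ L) (hμ : 0 < μ) (hL : 0 ≤ L)
    (hc : 0 < c) (hJ : (1 / 2) ^ J * L / (2 * μ) < 1 - c) {tol : ℝ} (htol : 0 < tol)
    {w₀ : E} (hw : F w₀ ≤ C) : ∃ n, StopsAfter F c tol w₀ n := by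
  classical
  have hex : ∀ w : {w // F w ≤ C}, ∃ w' : {w // F w ≤ C}, IsGuardedStep F c w.1 w'.1 := by
    rintro ⟨w, hw⟩
    obtain ⟨w', hw'⟩ := h.exists_isGuardedStep hμ hL hw hJ
    exact ⟨⟨w', (h.apply_le_of_step hc hw'.ties).trans hw⟩, hw'⟩
  choose next hnext using hex
  set run : ℕ → {w // F w ≤ C} := fun k => next^[k] ⟨w₀, hw⟩ with hrun
  have hstep : ∀ k, IsGuardedStep F c (run k).1 (run (k + 1)).1 := by
    intro k
    simp only [hrun, Function.iterate_succ_apply']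
    exact hnext _
  have hbelow : ∃ k, predictedReduction F (run k).1 < tol := by
    by_contra! hno
    have := h.steps_le hμ hL hc hJ htol (w := fun k => (run k).1)
      (n := ⌊C / (c * (1 / 2) ^ J * tol)⌋₊ + 1) (run 0).2 fun k _ => ⟨hno k, (hstep k).ties⟩
    omega
  exact ⟨Nat.find hbelow, fun k => (run k).1, rfl,
    fun k hk => ⟨not_lt.1 (Nat.find_min hbelow hk), hstep k⟩, Nat.find_spec hbelow⟩

end NewtonBounds

/-! ### Behaviour under an affine change of variables -/

lemma hasGradientAt_of_hasFDerivAt {F : E → ℝ} {v w : E} (h : HasFDerivAt F (innerSL ℝ v) w) :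
    HasGradientAt F v w := by
  rw [hasGradientAt_iff_hasFDerivAt]
  exact h.congr_fderiv (by ext; simp)

lemma hasFDerivAt_innerSL {F : E → ℝ} {v w : E} (h : HasGradientAt F v w) :
    HasFDerivAt F (innerSL ℝ v) w := by
  rw [hasGradientAt_iff_hasFDerivAt] at h
  exact h.congr_fderiv (by ext; simp)

section Rescale

variable {F G : E → ℝ} {g : E → E} {H : E → E →L[ℝ] E} {p : E} {t κ C₀ : ℝ}

lemma HasNewtonData.rescale (h : HasNewtonData G g H) (ht : t ≠ 0) (hκ : 0 < κ)
    (hF : ∀ ω, F (p + t • ω) = κ * G ω + C₀) :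
    HasNewtonData F (fun w => (κ * t⁻¹) • g (t⁻¹ • (w - p)))
      (fun w => (κ * t⁻¹ ^ 2) • H (t⁻¹ • (w - p))) := by
  have hFG : F = fun w => κ * G (t⁻¹ • (w - p)) + C₀ := by
    funext w
    rw [← hF, smul_smul, mul_inv_cancel₀ ht, one_smul, add_sub_cancel]
  have hA : ∀ w, HasFDerivAt (fun w : E => t⁻¹ • (w - p)) (t⁻¹ • ContinuousLinearMap.id ℝ E) w :=
    fun w => ((hasFDerivAt_id w).sub_const p).const_smul t⁻¹
  refine ⟨fun w => ?_, fun w => ?_, fun w v hv => ?_⟩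
  · rw [hFG]
    apply hasGradientAt_of_hasFDerivAt
    refine ((((hasFDerivAt_innerSL (h.grad _)).comp w (hA w)).const_mul κ).add_const
      C₀).congr_fderiv ?_
    ext v
    simp [mul_assoc]
  · refine (((h.hess _).comp w (hA w)).const_smul (κ * t⁻¹)).congr_fderiv ?_
    ext v
    simp [smul_smul, mul_assoc, sq]
  · have := h.pos (t⁻¹ • (w - p)) v hv
    have h2 : 0 < t⁻¹ ^ 2 := by positivity
    simp only [smul_apply, real_inner_smul_left]
    positivity

variable (h : HasNewtonData G g H) (ht : t ≠ 0) (hκ : 0 < κ)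
  (hF : ∀ ω, F (p + t • ω) = κ * G ω + C₀)

include h ht hκ hF

lemma newtonDir_rescale (ω : E) : newtonDir F (p + t • ω) = t • newtonDir G ω := by
  apply (h.rescale ht hκ hF).newtonDir_eq
  simp only [add_sub_cancel_left, smul_smul, inv_mul_cancel₀ ht, one_smul,
    smul_apply, map_smul, h.hess_newtonDir, smul_neg]
  congr 2
  field_simp

lemma inner_newtonDir_rescale (ω : E) :
    inner ℝ (newtonDir F (p + t • ω)) (gradient F (p + t • ω)) =
      κ * inner ℝ (newtonDir G ω) (gradient G ω) := by
  rw [newtonDir_rescale h ht hκ hF, (h.rescale ht hκ hF).gradient_eq, h.gradient_eq]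
  simp only [add_sub_cancel_left, smul_smul, inv_mul_cancel₀ ht, one_smul, real_inner_smul_left,
    real_inner_smul_right]
  field_simp

lemma predictedReduction_rescale (ω : E) :
    predictedReduction F (p + t • ω) = κ * predictedReduction G ω := by
  rw [predictedReduction, inner_newtonDir_rescale h ht hκ hF, abs_mul, abs_of_pos hκ,
    predictedReduction]

lemma trialValue_rescale (ω : E) (j : ℕ) :
    trialValue F (p + t • ω) j = κ * trialValue G ω j + C₀ := by
  rw [trialValue, newtonDir_rescale h ht hκ hF, trialValue, ← hF, smul_add, add_assoc,
    smul_comm t]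

lemma armijoBound_rescale (c : ℝ) (ω : E) (j : ℕ) :
    armijoBound F c (p + t • ω) j = κ * armijoBound G c ω j + C₀ := by
  rw [armijoBound, inner_newtonDir_rescale h ht hκ hF, hF, armijoBound]
  ring

/-- The guarded Newton method is affine invariant. -/
lemma StopsAfter.rescale {c tol : ℝ} {ω₀ : E} {n : ℕ} (hG : StopsAfter G c tol ω₀ n) :
    StopsAfter F c (κ * tol) (p + t • ω₀) n := by
  obtain ⟨w, rfl, hs, hn⟩ := hG
  refine ⟨fun k => p + t • w k, rfl, fun k hk => ⟨?_, ?_⟩, ?_⟩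
  · rw [predictedReduction_rescale h ht hκ hF]
    have := (hs k hk).1
    gcongr
  · obtain ⟨j, h1, h2, h3⟩ := (hs k hk).2
    refine ⟨j, ?_, fun i hi => ?_, ?_⟩
    · rw [trialValue_rescale h ht hκ hF, armijoBound_rescale h ht hκ hF]
      gcongr
    · rw [trialValue_rescale h ht hκ hF, armijoBound_rescale h ht hκ hF]
      have := h2 i hi
      gcongr
    · simp only [newtonDir_rescale h ht hκ hF, h3]
      rw [smul_add, add_assoc, smul_comm t]
  · rw [predictedReduction_rescale h ht hκ hF]
    gcongr

end Rescale

/-! ### Limits of runs -/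

/-- A run of bounded length with bounded backtracking, for functions that converge together with
their Newton directions, converges along an ultrafilter to a run of the limit function in which
ties are decided in some way. -/
lemma exists_stopsAfterTies_of_tendsto {ι : Type*} {l : Ultrafilter ι} {F : ι → E → ℝ} {f : E → ℝ}
    {c tol : ℝ} {J M : ℕ}
    (hdir : ∀ (ω : ι → E) (a : E), Tendsto ω l (𝓝 a) →
      Tendsto (fun k => newtonDir (F k) (ω k)) l (𝓝 (newtonDir f a)))
    (hred : ∀ (ω : ι → E) (a : E), Tendsto ω l (𝓝 a) →
      Tendsto (fun k => predictedReduction (F k) (ω k)) l (𝓝 (predictedReduction f a)))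
    (hgap : ∀ (ω : ι → E) (a : E) (j : ℕ), Tendsto ω l (𝓝 a) →
      Tendsto (fun k => trialValue (F k) (ω k) j - armijoBound (F k) c (ω k) j) l
        (𝓝 (trialValue f a j - armijoBound f c a j)))
    {n : ι → ℕ} {w : ι → ℕ → E} (hn : ∀ᶠ k in l, n k ≤ M)
    (hstep : ∀ k, ∀ i < n k, tol ≤ predictedReduction (F k) (w k i) ∧
      ∃ j ≤ J, trialValue (F k) (w k i) j ≤ armijoBound (F k) c (w k i) j ∧
        (∀ i' < j, armijoBound (F k) c (w k i) i' ≤ trialValue (F k) (w k i) i') ∧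
        w k (i + 1) = w k i + ((1 / 2 : ℝ) ^ j) • newtonDir (F k) (w k i))
    (hend : ∀ k, predictedReduction (F k) (w k (n k)) < tol)
    {a₀ : E} (h0 : Tendsto (fun k => w k 0) l (𝓝 a₀)) :
    ∃ N₀ : ℕ, (∀ᶠ k in l, n k = N₀) ∧ StopsAfterTies f c tol a₀ N₀ := by
  have pigeon : ∀ (q : ι → ℕ) (B : ℕ), (∀ᶠ k in l, q k ≤ B) → ∃ b, ∀ᶠ k in l, q k = b := by
    intro q B hq
    have : ∀ᶠ k in l, ∃ b ∈ Set.Iic B, q k = b := by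
      filter_upwards [hq] with k hk using ⟨q k, hk, rfl⟩
    obtain ⟨b, -, hb⟩ := (Ultrafilter.eventually_exists_mem_iff (Set.finite_Iic B)).1 this
    exact ⟨b, hb⟩
  obtain ⟨N₀, hN₀⟩ := pigeon n M hn
  refine ⟨N₀, hN₀, ?_⟩
  have hstepLim : ∀ i < N₀, ∀ a, Tendsto (fun k => w k i) l (𝓝 a) →
      tol ≤ predictedReduction f a ∧ ∃ a', Tendsto (fun k => w k (i + 1)) l (𝓝 a') ∧
        IsGuardedStepTies f c a a' := by
    intro i hi a ha
    have hex : ∀ k, ∃ j, i < n k → j ≤ J ∧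
        trialValue (F k) (w k i) j ≤ armijoBound (F k) c (w k i) j ∧
        (∀ i' < j, armijoBound (F k) c (w k i) i' ≤ trialValue (F k) (w k i) i') ∧
        w k (i + 1) = w k i + ((1 / 2 : ℝ) ^ j) • newtonDir (F k) (w k i) := by
      intro k
      by_cases hk : i < n k
      · obtain ⟨j, h⟩ := (hstep k i hk).2
        exact ⟨j, fun _ => h⟩
      · exact ⟨0, fun h => absurd h hk⟩
    choose j hj using hex
    have hlt : ∀ᶠ k in l, i < n k := hN₀.mono fun k hk => hk ▸ hi
    obtain ⟨b, hb⟩ := pigeon j J (hlt.mono fun k hk => (hj k hk).1)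
    refine ⟨ge_of_tendsto (hred _ a ha) (hlt.mono fun k hk => (hstep k i hk).1),
      a + ((1 / 2 : ℝ) ^ b) • newtonDir f a, ?_, b, ?_, fun i' hi' => ?_, rfl⟩
    · refine (ha.add ((hdir _ a ha).const_smul ((1 / 2 : ℝ) ^ b))).congr' ?_
      filter_upwards [hlt, hb] with k hk hbk
      rw [(hj k hk).2.2.2, hbk]
    · refine sub_nonpos.1 (le_of_tendsto (hgap _ a b ha) ?_)
      filter_upwards [hlt, hb] with k hk hbk
      have := (hj k hk).2.1
      rw [hbk] at this
      exact sub_nonpos.2 this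
    · refine sub_nonneg.1 (ge_of_tendsto (hgap _ a i' ha) ?_)
      filter_upwards [hlt, hb] with k hk hbk
      exact sub_nonneg.2 ((hj k hk).2.2.1 i' (hbk ▸ hi'))
  have hlim : ∀ i, ∃ a, i ≤ N₀ → Tendsto (fun k => w k i) l (𝓝 a) := by
    intro i
    induction i with
    | zero => exact ⟨a₀, fun _ => h0⟩
    | succ i ih =>
      obtain ⟨a, ha⟩ := ih
      by_cases hi : i < N₀
      · obtain ⟨-, a', ha', -⟩ := hstepLim i hi a (ha hi.le)
        exact ⟨a', fun _ => ha'⟩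
      · exact ⟨a, fun h => absurd h hi⟩
  choose A hA using hlim
  refine ⟨A, tendsto_nhds_unique (hA 0 (Nat.zero_le _)) h0, fun k hk => ?_, ?_⟩
  · obtain ⟨h1, a', ha', h2⟩ := hstepLim k hk (A k) (hA k hk.le)
    rw [← tendsto_nhds_unique (hA (k + 1) hk) ha'] at h2
    exact ⟨h1, h2⟩
  · refine le_of_tendsto (hred _ _ (hA N₀ le_rfl)) ?_
    filter_upwards [hN₀] with k hk
    have := hend k
    rw [hk] at this
    exact this.le

end Newton

/-! ### A family of functions that contains the rescaled objectives and their limit -/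

section Family

variable {E : Type*} [NormedAddCommGroup E] [InnerProductSpace ℝ E] [CompleteSpace E]
  [FiniteDimensional ℝ E] {κ ι : Type*} [Fintype κ] [Fintype ι]

/-- The limiting function `∑ ψ(⟪eᵢ, ω⟫) - θᵢ ⟪eᵢ, ω⟫`, plus a quadratic term and `μ` times a sum of
terms `ψ(τⱼ + ⟪bⱼ, ω⟫)`. For `q = μ = 0` this is the limiting function; the rescaled smoothed
objective has `μ = 1`, and `q → 0`, `τⱼ → -∞` as the smoothing parameter tends to `0`. -/
noncomputable def ridgeFun (e : κ → E) (θ : κ → ℝ) (b : ι → E) (q μ : ℝ) (τ : ι → ℝ) (ω : E) : ℝ :=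
  ∑ i, (psi (inner ℝ (e i) ω) - θ i * inner ℝ (e i) ω)
    + (q / 2 * ‖ω‖ ^ 2 + μ * ∑ j, psi (τ j + inner ℝ (b j) ω))

/-- The gradient of `ridgeFun`. -/
noncomputable def ridgeGrad (e : κ → E) (θ : κ → ℝ) (b : ι → E) (q μ : ℝ) (τ : ι → ℝ) (ω : E) : E :=
  ∑ i, (dpsi (inner ℝ (e i) ω) - θ i) • e i
    + (q • ω + μ • ∑ j, dpsi (τ j + inner ℝ (b j) ω) • b j)

/-- The Hessian of `ridgeFun`. -/
noncomputable def ridgeHess (e : κ → E) (b : ι → E) (q μ : ℝ) (τ : ι → ℝ) (ω : E) : E →L[ℝ] E :=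
  ∑ i, ddpsi (inner ℝ (e i) ω) • (innerSL ℝ (e i)).smulRight (e i)
    + (q • ContinuousLinearMap.id ℝ E
      + μ • ∑ j, ddpsi (τ j + inner ℝ (b j) ω) • (innerSL ℝ (b j)).smulRight (b j))

variable {e : κ → E} {θ : κ → ℝ} {b : ι → E} {q μ : ℝ} {τ : ι → ℝ}

lemma hasFDerivAt_inner_right (v w : E) :
    HasFDerivAt (fun ω : E => inner ℝ v ω) (innerSL ℝ v) w := (innerSL ℝ v).hasFDerivAt

lemma hasGradientAt_ridgeFun (ω : E) :
    HasGradientAt (ridgeFun e θ b q μ τ) (ridgeGrad e θ b q μ τ ω) ω := by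
  apply hasGradientAt_of_hasFDerivAt
  have h1 : ∀ i, HasFDerivAt (fun ω : E => psi (inner ℝ (e i) ω) - θ i * inner ℝ (e i) ω)
      (dpsi (inner ℝ (e i) ω) • innerSL ℝ (e i) - θ i • innerSL ℝ (e i)) ω := fun i =>
    ((hasDerivAt_psi _).comp_hasFDerivAt ω (hasFDerivAt_inner_right (e i) ω)).sub
      ((hasFDerivAt_inner_right (e i) ω).const_mul (θ i))
  have h2 : ∀ j, HasFDerivAt (fun ω : E => psi (τ j + inner ℝ (b j) ω))
      (dpsi (τ j + inner ℝ (b j) ω) • innerSL ℝ (b j)) ω := fun j =>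
    (hasDerivAt_psi _).comp_hasFDerivAt ω ((hasFDerivAt_inner_right (b j) ω).const_add (τ j))
  have h3 := (hasStrictFDerivAt_norm_sq ω).hasFDerivAt.const_mul (q / 2)
  refine ((HasFDerivAt.fun_sum fun i (_ : i ∈ Finset.univ) => h1 i).add
    (h3.add ((HasFDerivAt.fun_sum fun j (_ : j ∈ Finset.univ) => h2 j).const_mul
      μ))).congr_fderiv ?_
  ext v
  simp [ridgeGrad, sub_mul]
  ring

lemma hasFDerivAt_ridgeGrad (ω : E) :
    HasFDerivAt (ridgeGrad e θ b q μ τ) (ridgeHess e b q μ τ ω) ω := by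
  have h1 : ∀ i, HasFDerivAt (fun ω : E => (dpsi (inner ℝ (e i) ω) - θ i) • e i)
      ((ddpsi (inner ℝ (e i) ω) • innerSL ℝ (e i)).smulRight (e i)) ω := fun i =>
    (((hasDerivAt_dpsi _).comp_hasFDerivAt ω (hasFDerivAt_inner_right (e i) ω)).sub_const
      (θ i)).smul_const (e i)
  have h2 : ∀ j, HasFDerivAt (fun ω : E => dpsi (τ j + inner ℝ (b j) ω) • b j)
      ((ddpsi (τ j + inner ℝ (b j) ω) • innerSL ℝ (b j)).smulRight (b j)) ω := fun j =>
    ((hasDerivAt_dpsi _).comp_hasFDerivAt ω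
      ((hasFDerivAt_inner_right (b j) ω).const_add (τ j))).smul_const (b j)
  refine ((HasFDerivAt.fun_sum fun i (_ : i ∈ Finset.univ) => h1 i).add
    (((hasFDerivAt_id ω).const_smul q).add
      ((HasFDerivAt.fun_sum fun j (_ : j ∈ Finset.univ) => h2 j).const_smul μ))).congr_fderiv ?_
  ext v
  simp [ridgeHess, smul_smul]

lemma inner_ridgeHess (ω u v : E) :
    inner ℝ (ridgeHess e b q μ τ ω u) v =
      ∑ i, ddpsi (inner ℝ (e i) ω) * (inner ℝ (e i) u * inner ℝ (e i) v)
      + (q * inner ℝ u v + μ * ∑ j, ddpsi (τ j + inner ℝ (b j) ω) *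
        (inner ℝ (b j) u * inner ℝ (b j) v)) := by
  simp [ridgeHess, inner_add_left, sum_inner, real_inner_smul_left]

lemma inner_ridgeHess_comm (ω u v : E) :
    inner ℝ (ridgeHess e b q μ τ ω u) v = inner ℝ u (ridgeHess e b q μ τ ω v) := by
  rw [real_inner_comm _ u, inner_ridgeHess, inner_ridgeHess, real_inner_comm]
  simp only [mul_comm (inner ℝ _ u)]

lemma sum_inner_sq_le_inner_ridgeHess (hq : 0 ≤ q) (hμ : 0 ≤ μ) (ω v : E) :
    ∑ i, ddpsi (inner ℝ (e i) ω) * inner ℝ (e i) v ^ 2 ≤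
      inner ℝ (ridgeHess e b q μ τ ω v) v := by
  rw [inner_ridgeHess]
  have h1 : 0 ≤ q * inner ℝ v v := mul_nonneg hq real_inner_self_nonneg
  have h2 : 0 ≤ μ * ∑ j, ddpsi (τ j + inner ℝ (b j) ω) * (inner ℝ (b j) v * inner ℝ (b j) v) :=
    mul_nonneg hμ (Finset.sum_nonneg fun j _ =>
      mul_nonneg (ddpsi_pos _).le (mul_self_nonneg _))
  simp only [sq]
  linarith

/-- A bound for the Hessians of all members of the family with `q, μ ≤ 1`. -/
noncomputable def curvBound (e : κ → E) (b : ι → E) : ℝ := ∑ i, ‖e i‖ ^ 2 + (1 + ∑ j, ‖b j‖ ^ 2)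

lemma curvBound_pos (e : κ → E) (b : ι → E) : 0 < curvBound e b := by
  unfold curvBound; positivity

lemma inner_sq_le (v w : E) : inner ℝ v w ^ 2 ≤ ‖v‖ ^ 2 * ‖w‖ ^ 2 := by
  rw [← mul_pow, ← sq_abs]
  gcongr
  exact abs_real_inner_le_norm v w

lemma sum_mul_inner_sq_le {ι' : Type*} [Fintype ι'] (x : ι' → E) {D : ι' → ℝ} {B : ℝ}
    (hB0 : 0 ≤ B) (hB : ∀ i, D i ≤ B) (v : E) :
    ∑ i, D i * inner ℝ (x i) v ^ 2 ≤ B * ((∑ i, ‖x i‖ ^ 2) * ‖v‖ ^ 2) := by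
  rw [Finset.sum_mul, Finset.mul_sum]
  gcongr with i
  · exact hB i
  · exact inner_sq_le _ _

lemma inner_ridgeHess_le (hq1 : q ≤ 1) (hμ1 : μ ≤ 1) (ω v : E) :
    inner ℝ (ridgeHess e b q μ τ ω v) v ≤ curvBound e b * ‖v‖ ^ 2 := by
  rw [inner_ridgeHess, real_inner_self_eq_norm_sq]
  simp only [← sq]
  have h1 := sum_mul_inner_sq_le e zero_le_one
    (fun i => (ddpsi_le (inner ℝ (e i) ω)).trans (by norm_num)) v
  have h2 := sum_mul_inner_sq_le b zero_le_one
    (fun j => (ddpsi_le (τ j + inner ℝ (b j) ω)).trans (by norm_num)) v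
  have h3 : q * ‖v‖ ^ 2 ≤ 1 * ‖v‖ ^ 2 := by gcongr
  have h4 : 0 ≤ ∑ j, ddpsi (τ j + inner ℝ (b j) ω) * inner ℝ (b j) v ^ 2 :=
    Finset.sum_nonneg fun j _ => mul_nonneg (ddpsi_pos _).le (sq_nonneg _)
  have h5 := mul_le_mul_of_nonneg_right hμ1 h4
  unfold curvBound
  linarith

lemma ridgeFun_descent (hq1 : q ≤ 1) (hμ : 0 ≤ μ) (hμ1 : μ ≤ 1) (ω v : E) :
    ridgeFun e θ b q μ τ (ω + v) ≤ ridgeFun e θ b q μ τ ω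
      + inner ℝ (ridgeGrad e θ b q μ τ ω) v + curvBound e b / 2 * ‖v‖ ^ 2 := by
  have h1 : ∑ i, (psi (inner ℝ (e i) (ω + v)) - θ i * inner ℝ (e i) (ω + v)) ≤
      ∑ i, (psi (inner ℝ (e i) ω) - θ i * inner ℝ (e i) ω)
      + ∑ i, (dpsi (inner ℝ (e i) ω) - θ i) * inner ℝ (e i) v
      + ∑ i, 1 / 4 * inner ℝ (e i) v ^ 2 := by
    rw [← Finset.sum_add_distrib, ← Finset.sum_add_distrib]
    refine Finset.sum_le_sum fun i _ => ?_
    have := psi_le_quadratic (inner ℝ (e i) ω) (inner ℝ (e i) (ω + v))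
    rw [inner_add_right] at this ⊢
    ring_nf at this ⊢
    linarith
  have h2 : ∑ j, psi (τ j + inner ℝ (b j) (ω + v)) ≤
      ∑ j, psi (τ j + inner ℝ (b j) ω) + ∑ j, dpsi (τ j + inner ℝ (b j) ω) * inner ℝ (b j) v
      + ∑ j, 1 / 4 * inner ℝ (b j) v ^ 2 := by
    rw [← Finset.sum_add_distrib, ← Finset.sum_add_distrib]
    refine Finset.sum_le_sum fun j _ => ?_
    have := psi_le_quadratic (τ j + inner ℝ (b j) ω) (τ j + inner ℝ (b j) (ω + v))
    rw [inner_add_right] at this ⊢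
    ring_nf at this ⊢
    linarith
  have h3 := sum_mul_inner_sq_le e (D := fun _ => 1 / 4) (B := 1 / 2) (by norm_num)
    (fun _ => by norm_num) v
  have h4 := sum_mul_inner_sq_le b (D := fun _ => 1 / 4) (B := 1 / 2) (by norm_num)
    (fun _ => by norm_num) v
  have h5 : 0 ≤ ∑ j, 1 / 4 * inner ℝ (b j) v ^ 2 := by positivity
  have h6 := mul_le_mul_of_nonneg_right hμ1 h5
  have h7 := mul_le_mul_of_nonneg_left h2 hμ
  have h8 : inner ℝ (ridgeGrad e θ b q μ τ ω) v =
      ∑ i, (dpsi (inner ℝ (e i) ω) - θ i) * inner ℝ (e i) v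
      + (q * inner ℝ ω v + μ * ∑ j, dpsi (τ j + inner ℝ (b j) ω) * inner ℝ (b j) v) := by
    simp [ridgeGrad, inner_add_left, sum_inner, real_inner_smul_left]
  have h9 : q * ‖v‖ ^ 2 ≤ 1 * ‖v‖ ^ 2 := by gcongr
  rw [h8, ridgeFun, ridgeFun, norm_add_sq_real]
  unfold curvBound
  linarith

lemma exists_forall_le_of_pos {κ : Type*} [Finite κ] {x : κ → ℝ} (hx : ∀ i, 0 < x i) :
    ∃ t > 0, ∀ i, t ≤ x i := by
  have h : ∀ᶠ t in 𝓝[>] (0 : ℝ), ∀ i, t ≤ x i :=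
    eventually_all.2 fun i => by
      filter_upwards [Ioc_mem_nhdsGT (hx i)] with t ht using ht.2
  obtain ⟨t, ht, h0⟩ := (h.and self_mem_nhdsWithin).exists
  exact ⟨t, h0, ht⟩

variable (U : E ≃L[ℝ] (κ → ℝ)) (hU : ∀ ω i, U ω i = inner ℝ (e i) ω)

include hU

lemma exists_mul_norm_le_abs_inner :
    ∃ a > 0, ∀ v, v ≠ 0 → ∃ i, a * ‖v‖ ≤ |inner ℝ (e i) v| := by
  set B := ‖(U.symm : (κ → ℝ) →L[ℝ] E)‖ with hB
  refine ⟨1 / (B + 1), by positivity, fun v hv => ?_⟩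
  have hv0 : 0 < ‖v‖ := norm_pos_iff.2 hv
  by_contra! hno
  have h1 : ‖U v‖ < 1 / (B + 1) * ‖v‖ := by
    rw [pi_norm_lt_iff (by positivity)]
    intro i
    rw [hU, Real.norm_eq_abs]
    exact hno i
  have h2 : ‖v‖ ≤ B * ‖U v‖ := by
    simpa using (U.symm : (κ → ℝ) →L[ℝ] E).le_opNorm (U v)
  have h3 : (B + 1) * ‖U v‖ < ‖v‖ := by
    rw [div_mul_eq_mul_div, one_mul, lt_div_iff₀ (by positivity)] at h1
    linarith
  have := norm_nonneg (U v)
  linarith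

lemma hasNewtonData_ridgeFun (hq : 0 ≤ q) (hμ : 0 ≤ μ) :
    HasNewtonData (ridgeFun e θ b q μ τ) (ridgeGrad e θ b q μ τ) (ridgeHess e b q μ τ) := by
  refine ⟨hasGradientAt_ridgeFun, hasFDerivAt_ridgeGrad, fun ω v hv => ?_⟩
  obtain ⟨a, ha, h⟩ := exists_mul_norm_le_abs_inner U hU
  obtain ⟨i, hi⟩ := h v hv
  refine lt_of_lt_of_le ?_ (sum_inner_sq_le_inner_ridgeHess hq hμ ω v)
  refine Finset.sum_pos' (fun i _ => mul_nonneg (ddpsi_pos _).le (sq_nonneg _))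
    ⟨i, Finset.mem_univ i, mul_pos (ddpsi_pos _) ?_⟩
  rw [← sq_abs]
  have : 0 < a * ‖v‖ := mul_pos ha (norm_pos_iff.2 hv)
  have := this.trans_le hi
  positivity

omit hU in
lemma ridgeFun_zero_le (hq : 0 ≤ q) (hμ : 0 ≤ μ) (τ' : ι → ℝ) (ω : E) :
    ridgeFun e θ b 0 0 τ' ω ≤ ridgeFun e θ b q μ τ ω := by
  have : 0 ≤ μ * ∑ j, psi (τ j + inner ℝ (b j) ω) :=
    mul_nonneg hμ (Finset.sum_nonneg fun j _ => (psi_pos _).le)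
  unfold ridgeFun
  simp only [zero_div, zero_mul, add_zero]
  have : 0 ≤ q / 2 * ‖ω‖ ^ 2 := by positivity
  linarith

/-- The bounds behind the Newton method hold uniformly over the family. -/
lemma exists_newtonBounds (hθ : ∀ i, 0 < θ i ∧ θ i < 1) (C : ℝ) :
    ∃ m > 0, ∀ q μ τ, 0 ≤ q → q ≤ 1 → 0 ≤ μ → μ ≤ 1 →
      NewtonBounds (ridgeFun e θ b q μ τ) (ridgeGrad e θ b q μ τ) (ridgeHess e b q μ τ)
        C m (curvBound e b) := by
  obtain ⟨a, ha, hA⟩ := exists_mul_norm_le_abs_inner U hU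
  obtain ⟨t, ht, hT⟩ := exists_forall_le_of_pos (x := fun i => min (θ i) (1 - θ i))
    fun i => lt_min (hθ i).1 (by linarith [(hθ i).2])
  have hterm : ∀ i u, t * |u| ≤ psi u - θ i * u := fun i u =>
    mul_abs_le_psi_sub ((hT i).trans (min_le_left _ _)) ((hT i).trans (min_le_right _ _)) u
  have hsum : ∀ {q μ τ}, 0 ≤ q → 0 ≤ μ → ∀ ω,
      ∑ i, (psi (inner ℝ (e i) ω) - θ i * inner ℝ (e i) ω) ≤ ridgeFun e θ b q μ τ ω := by
    intro q μ τ hq hμ ω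
    have := ridgeFun_zero_le (e := e) (θ := θ) (b := b) (τ := τ) hq hμ τ ω
    refine le_trans (le_of_eq ?_) this
    simp [ridgeFun]
  have hnn : ∀ i u, 0 ≤ psi u - θ i * u := fun i u => le_trans (by positivity) (hterm i u)
  refine ⟨ddpsi (C / t) * a ^ 2, mul_pos (ddpsi_pos _) (by positivity),
    fun q μ τ hq hq1 hμ hμ1 => ⟨hasNewtonData_ridgeFun U hU hq hμ, fun ω => ?_,
      ridgeFun_descent hq1 hμ hμ1, fun ω v hC => ?_⟩⟩
  · exact (Finset.sum_nonneg fun i _ => hnn i _).trans (hsum hq hμ ω)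
  · by_cases hv : v = 0
    · simp [hv]
    obtain ⟨i, hi⟩ := hA v hv
    refine le_trans ?_ (sum_inner_sq_le_inner_ridgeHess hq hμ ω v)
    have h1 : ddpsi (inner ℝ (e i) ω) * inner ℝ (e i) v ^ 2 ≤
        ∑ i, ddpsi (inner ℝ (e i) ω) * inner ℝ (e i) v ^ 2 :=
      Finset.single_le_sum (f := fun i => ddpsi (inner ℝ (e i) ω) * inner ℝ (e i) v ^ 2)
        (fun i _ => mul_nonneg (ddpsi_pos _).le (sq_nonneg _)) (Finset.mem_univ i)
    refine le_trans ?_ h1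
    have h2 : |inner ℝ (e i) ω| ≤ C / t := by
      rw [le_div_iff₀ ht, mul_comm]
      refine (hterm i _).trans (le_trans ?_ ((hsum hq hμ ω).trans hC))
      exact Finset.single_le_sum
        (f := fun i => psi (inner ℝ (e i) ω) - θ i * inner ℝ (e i) ω)
        (fun i _ => hnn i _) (Finset.mem_univ i)
    rw [mul_assoc, ← mul_pow]
    have h3 := ddpsi_le_ddpsi_of_abs_le h2
    rw [← sq_abs (inner ℝ (e i) v)]
    have := ddpsi_pos (inner ℝ (e i) ω)
    gcongr

/-! ### Convergence of the family -/

/-- Away from the minimizer `d`, the gradient of the limiting function has slope bounded below in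
the direction that leads away from `d`. -/
lemma exists_mul_norm_le_inner_ridgeGrad {d : E} (hd : ∀ i, dpsi (inner ℝ (e i) d) = θ i)
    (τ : ι → ℝ) : ∃ a > 0, ∀ ω, 1 ≤ ‖ω - d‖ →
      a * ‖ω - d‖ ≤ inner ℝ (ridgeGrad e θ b 0 0 τ ω) (ω - d) := by
  obtain ⟨a, ha, hA⟩ := exists_mul_norm_le_abs_inner U hU
  choose c hc hcle using fun i => exists_mul_min_le_abs_dpsi_sub (inner ℝ (e i) d)
  obtain ⟨t, ht, hT⟩ := exists_forall_le_of_pos hc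
  refine ⟨t * min 1 a * a, by positivity, fun ω hω => ?_⟩
  have hv : ω - d ≠ 0 := norm_pos_iff.1 (by linarith)
  obtain ⟨i, hi⟩ := hA _ hv
  have h1 : inner ℝ (ridgeGrad e θ b 0 0 τ ω) (ω - d) =
      ∑ i, (dpsi (inner ℝ (e i) ω) - dpsi (inner ℝ (e i) d))
        * (inner ℝ (e i) ω - inner ℝ (e i) d) := by
    simp [ridgeGrad, sum_inner, real_inner_smul_left, hd, inner_sub_right, mul_sub]
  have h2 : ∀ i, 0 ≤ (dpsi (inner ℝ (e i) ω) - dpsi (inner ℝ (e i) d))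
        * (inner ℝ (e i) ω - inner ℝ (e i) d) := fun i => dpsi_sub_mul_sub_nonneg _ _
  rw [h1]
  refine le_trans ?_ (Finset.single_le_sum
    (f := fun i => (dpsi (inner ℝ (e i) ω) - dpsi (inner ℝ (e i) d))
        * (inner ℝ (e i) ω - inner ℝ (e i) d)) (fun i _ => h2 i) (Finset.mem_univ i))
  rw [inner_sub_right] at hi
  have h3 := hcle i (inner ℝ (e i) ω)
  rw [← abs_of_nonneg (h2 i), abs_mul, mul_assoc]
  have h4 : a ≤ |inner ℝ (e i) ω - inner ℝ (e i) d| :=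
    le_trans (by nlinarith) hi
  gcongr
  refine le_trans ?_ h3
  have := (hc i).le
  gcongr
  exact hT i

/-- For small perturbations of the limiting function, small predicted reduction forces a point to
lie in the unit ball about the minimizer of the limiting function. -/
lemma exists_norm_sub_lt_of_predictedReduction_lt {d : E}
    (hd : ∀ i, dpsi (inner ℝ (e i) d) = θ i) :
    ∃ t₀ > 0, ∃ r > 0, ∀ q μ τ, 0 ≤ q → q ≤ 1 → 0 ≤ μ → μ ≤ 1 →
      ‖ridgeGrad e θ b q μ τ d‖ ≤ r →
      ∀ ω, predictedReduction (ridgeFun e θ b q μ τ) ω < t₀ → ‖ω - d‖ < 1 := by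
  obtain ⟨a, ha, hA⟩ := exists_mul_norm_le_inner_ridgeGrad (b := b) U hU hd 0
  refine ⟨(a / 2) ^ 2 / curvBound e b, div_pos (by positivity) (curvBound_pos e b), a / 2,
    by positivity, fun q μ τ hq hq1 hμ hμ1 hr ω hω => ?_⟩
  by_contra! hge
  refine absurd hω (not_lt.2 ?_)
  have hv : ω - d ≠ 0 := norm_pos_iff.1 (by linarith)
  refine (hasNewtonData_ridgeFun U hU hq hμ).le_predictedReduction (by positivity)
    (curvBound_pos e b) hv ?_ (inner_ridgeHess_le hq1 hμ1 _ _) (inner_ridgeHess_comm ω)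
  -- the terms added to the limiting function are convex, so their slope towards `ω` is at least
  -- the one at `d`
  have h1 : inner ℝ (ridgeGrad e θ b q μ τ ω) (ω - d) =
      inner ℝ (ridgeGrad e θ b 0 0 0 ω) (ω - d) + inner ℝ (ridgeGrad e θ b q μ τ d) (ω - d)
      + (q * ‖ω - d‖ ^ 2 + μ * ∑ j, (dpsi (τ j + inner ℝ (b j) ω) - dpsi (τ j + inner ℝ (b j) d))
        * ((τ j + inner ℝ (b j) ω) - (τ j + inner ℝ (b j) d))) := by
    have e1 : ∀ j, (τ j + inner ℝ (b j) ω) - (τ j + inner ℝ (b j) d) = inner ℝ (b j) (ω - d) := by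
      intro j; rw [inner_sub_right]; ring
    have e2 : q * ‖ω - d‖ ^ 2 = q * inner ℝ ω (ω - d) - q * inner ℝ d (ω - d) := by
      rw [← real_inner_self_eq_norm_sq, inner_sub_left]; ring
    simp only [e1, e2]
    simp [ridgeGrad, inner_add_left, sum_inner, real_inner_smul_left, hd, sub_mul,
      Finset.sum_sub_distrib]
    ring
  have h2 : 0 ≤ q * ‖ω - d‖ ^ 2 + μ * ∑ j,
      (dpsi (τ j + inner ℝ (b j) ω) - dpsi (τ j + inner ℝ (b j) d))
        * ((τ j + inner ℝ (b j) ω) - (τ j + inner ℝ (b j) d)) :=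
    add_nonneg (by positivity) (mul_nonneg hμ (Finset.sum_nonneg fun j _ =>
      dpsi_sub_mul_sub_nonneg _ _))
  have h3 := abs_real_inner_le_norm (ridgeGrad e θ b q μ τ d) (ω - d)
  have h4 : ‖ridgeGrad e θ b q μ τ d‖ * ‖ω - d‖ ≤ a / 2 * ‖ω - d‖ := by gcongr
  have h5 := hA ω hge
  have h6 := (abs_le.1 h3).1
  rw [h1]
  linarith

section Limit

variable {α : Type*} {l : Filter α} {Q : α → ℝ} {T : α → ι → ℝ} {ω : α → E} {p : E}
  (hQ : Tendsto Q l (𝓝 0)) (hT : ∀ j, Tendsto (fun k => T k j) l atBot)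
  (hω : Tendsto ω l (𝓝 p))

include hQ hT hω

omit hU hQ in
lemma tendsto_ridge_arg (j : ι) :
    Tendsto (fun k => T k j + inner ℝ (b j) (ω k)) l atBot :=
  (hT j).atBot_add (tendsto_const_nhds.inner hω)

omit hU in
lemma tendsto_ridgeFun (τ : ι → ℝ) :
    Tendsto (fun k => ridgeFun e θ b (Q k) 1 (T k) (ω k)) l (𝓝 (ridgeFun e θ b 0 0 τ p)) := by
  have h1 : Continuous fun ω : E => ∑ i, (psi (inner ℝ (e i) ω) - θ i * inner ℝ (e i) ω) := by
    fun_prop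
  have h2 : Tendsto (fun k => ∑ j, psi (T k j + inner ℝ (b j) (ω k))) l (𝓝 (∑ j : ι, 0)) :=
    tendsto_finsetSum _ fun j _ => tendsto_psi_atBot.comp (tendsto_ridge_arg hT hω j)
  have := ((h1.tendsto p).comp hω).add
    (((hQ.div_const 2).mul (hω.norm.pow 2)).add (h2.const_mul 1))
  simpa [ridgeFun] using this

omit hU in
lemma tendsto_ridgeGrad (τ : ι → ℝ) :
    Tendsto (fun k => ridgeGrad e θ b (Q k) 1 (T k) (ω k)) l (𝓝 (ridgeGrad e θ b 0 0 τ p)) := by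
  have h1 : Continuous fun ω : E => ∑ i, (dpsi (inner ℝ (e i) ω) - θ i) • e i := by
    fun_prop
  have h2 : Tendsto (fun k => ∑ j, dpsi (T k j + inner ℝ (b j) (ω k)) • b j) l
      (𝓝 (∑ j : ι, (0 : ℝ) • b j)) :=
    tendsto_finsetSum _ fun j _ =>
      (tendsto_dpsi_atBot.comp (tendsto_ridge_arg hT hω j)).smul_const (b j)
  have := ((h1.tendsto p).comp hω).add ((hQ.smul hω).add (h2.const_smul (1 : ℝ)))
  simpa [ridgeGrad] using this

omit hU in
lemma tendsto_ridgeHess (τ : ι → ℝ) (v : E) :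
    Tendsto (fun k => ridgeHess e b (Q k) 1 (T k) (ω k) v) l (𝓝 (ridgeHess e b 0 0 τ p v)) := by
  have h1 : Continuous fun ω : E => ∑ i, ddpsi (inner ℝ (e i) ω) • inner ℝ (e i) v • e i := by
    fun_prop
  have h2 : Tendsto (fun k => ∑ j, ddpsi (T k j + inner ℝ (b j) (ω k)) • inner ℝ (b j) v • b j) l
      (𝓝 (∑ j : ι, (0 : ℝ) • inner ℝ (b j) v • b j)) :=
    tendsto_finsetSum _ fun j _ =>
      (tendsto_ddpsi_atBot.comp (tendsto_ridge_arg hT hω j)).smul_const _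
  have := ((h1.tendsto p).comp hω).add ((hQ.smul_const v).add (h2.const_smul (1 : ℝ)))
  simpa [ridgeHess, sum_apply] using this

variable (hQ0 : ∀ᶠ k in l, 0 ≤ Q k) (hθ : ∀ i, 0 < θ i ∧ θ i < 1)

include hQ0 hθ

lemma tendsto_newtonDir (τ : ι → ℝ) :
    Tendsto (fun k => newtonDir (ridgeFun e θ b (Q k) 1 (T k)) (ω k)) l
      (𝓝 (newtonDir (ridgeFun e θ b 0 0 τ) p)) := by
  obtain ⟨m, hm, hB⟩ := exists_newtonBounds (b := b) U hU hθ (ridgeFun e θ b 0 0 τ p + 1)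
  have hF := tendsto_ridgeFun (e := e) (θ := θ) (b := b) hQ hT hω τ
  set δ := newtonDir (ridgeFun e θ b 0 0 τ) p with hδ
  have hδ' : ridgeHess e b 0 0 τ p δ = -ridgeGrad e θ b 0 0 τ p :=
    (hB 0 0 τ le_rfl zero_le_one le_rfl zero_le_one).hess_newtonDir p
  have hlim : Tendsto (fun k => m⁻¹ * ‖-ridgeGrad e θ b (Q k) 1 (T k) (ω k)
      - ridgeHess e b (Q k) 1 (T k) (ω k) δ‖) l (𝓝 0) := by
    have := (((tendsto_ridgeGrad (e := e) (θ := θ) (b := b) hQ hT hω τ).neg.sub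
      (tendsto_ridgeHess (e := e) (b := b) hQ hT hω τ δ)).norm).const_mul m⁻¹
    rw [hδ', sub_self, norm_zero, mul_zero] at this
    exact this
  rw [tendsto_iff_norm_sub_tendsto_zero]
  refine squeeze_zero' (Eventually.of_forall fun k => norm_nonneg _) ?_ hlim
  filter_upwards [hQ0, hQ.eventually_le_const one_pos,
    hF.eventually_le_const (lt_add_one _)] with k h0 h1 hC
  have hN := hB (Q k) 1 (T k) h0 h1 zero_le_one le_rfl
  set x := newtonDir (ridgeFun e θ b (Q k) 1 (T k)) (ω k) - δ with hx
  have h2 := hN.curv (ω k) x hC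
  have h3 : ridgeHess e b (Q k) 1 (T k) (ω k) x = -ridgeGrad e θ b (Q k) 1 (T k) (ω k)
      - ridgeHess e b (Q k) 1 (T k) (ω k) δ := by
    rw [hx, map_sub, hN.hess_newtonDir]
  rw [← h3, inv_mul_eq_div, le_div_iff₀ hm]
  have h4 := h2.trans (real_inner_le_norm _ _)
  rcases (norm_nonneg x).eq_or_lt with hx0 | hx0
  · rw [← hx0]; simp
  · exact le_of_mul_le_mul_right (by linarith) hx0

lemma tendsto_inner_newtonDir_gradient (τ : ι → ℝ) :
    Tendsto (fun k => inner ℝ (newtonDir (ridgeFun e θ b (Q k) 1 (T k)) (ω k))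
      (gradient (ridgeFun e θ b (Q k) 1 (T k)) (ω k))) l
      (𝓝 (inner ℝ (newtonDir (ridgeFun e θ b 0 0 τ) p) (gradient (ridgeFun e θ b 0 0 τ) p))) := by
  have h : ∀ q μ τ, gradient (ridgeFun e θ b q μ τ) = ridgeGrad e θ b q μ τ := fun q μ τ =>
    funext fun w => (hasGradientAt_ridgeFun w).gradient
  simp only [h]
  exact (tendsto_newtonDir U hU hQ hT hω hQ0 hθ τ).inner (tendsto_ridgeGrad hQ hT hω τ)

lemma tendsto_predictedReduction (τ : ι → ℝ) :
    Tendsto (fun k => predictedReduction (ridgeFun e θ b (Q k) 1 (T k)) (ω k)) l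
      (𝓝 (predictedReduction (ridgeFun e θ b 0 0 τ) p)) :=
  (tendsto_inner_newtonDir_gradient U hU hQ hT hω hQ0 hθ τ).abs

lemma tendsto_trialValue_sub_armijoBound (c : ℝ) (j : ℕ) (τ : ι → ℝ) :
    Tendsto (fun k => trialValue (ridgeFun e θ b (Q k) 1 (T k)) (ω k) j
        - armijoBound (ridgeFun e θ b (Q k) 1 (T k)) c (ω k) j) l
      (𝓝 (trialValue (ridgeFun e θ b 0 0 τ) p j - armijoBound (ridgeFun e θ b 0 0 τ) c p j)) := by
  unfold trialValue armijoBound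
  exact (tendsto_ridgeFun hQ hT (hω.add
    ((tendsto_newtonDir U hU hQ hT hω hQ0 hθ τ).const_smul _)) τ).sub
    ((tendsto_ridgeFun hQ hT hω τ).add
      ((tendsto_inner_newtonDir_gradient U hU hQ hT hω hQ0 hθ τ).const_mul _))

end Limit

end Family

/-! ### Step counts of the smoothed problems and of the limiting problem -/

section Count

variable {E : Type*} [NormedAddCommGroup E] [InnerProductSpace ℝ E] [CompleteSpace E]
  [FiniteDimensional ℝ E] {κ ι : Type*} [Fintype κ] [Fintype ι]
  {e : κ → E} {θ : κ → ℝ} {b : ι → E}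

lemma continuous_ridgeFun (q μ : ℝ) (τ : ι → ℝ) : Continuous (ridgeFun e θ b q μ τ) :=
  continuous_iff_continuousAt.2 fun ω => (hasGradientAt_ridgeFun ω).continuousAt

lemma ridgeFun_le_ridgeFun_one {q μ : ℝ} {τ : ι → ℝ} (hq1 : q ≤ 1) (hμ1 : μ ≤ 1)
    (hτ : ∀ j, τ j ≤ 0) (ω : E) :
    ridgeFun e θ b q μ τ ω ≤ ridgeFun e θ b 1 1 0 ω := by
  have h1 : ∑ j, psi (τ j + inner ℝ (b j) ω) ≤ ∑ j, psi ((0 : ι → ℝ) j + inner ℝ (b j) ω) :=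
    Finset.sum_le_sum fun j _ => monotone_psi (by simpa using hτ j)
  have h2 : 0 ≤ ∑ j, psi (τ j + inner ℝ (b j) ω) := Finset.sum_nonneg fun j _ => (psi_pos _).le
  have h3 := mul_le_mul_of_nonneg_right hμ1 h2
  have h4 : q / 2 * ‖ω‖ ^ 2 ≤ 1 / 2 * ‖ω‖ ^ 2 := by gcongr
  unfold ridgeFun
  linarith

lemma exists_ridgeFun_le_of_start (d : E) {β : ℝ} (hβ : 0 < β) :
    ∃ C, ∀ ω, ‖β • ω - d‖ < 1 → ridgeFun e θ b 1 1 0 ω ≤ C := by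
  have hc : Continuous fun ω => ridgeFun e θ b 1 1 0 (β⁻¹ • ω) :=
    (continuous_ridgeFun 1 1 0).comp (continuous_const_smul _)
  obtain ⟨C, hC⟩ := ((isCompact_closedBall d 1).image hc).bddAbove
  refine ⟨C, fun ω hω => hC ⟨β • ω, ?_, ?_⟩⟩
  · rw [mem_closedBall_iff_norm]; exact hω.le
  · simp [smul_smul, inv_mul_cancel₀ hβ.ne']

lemma exists_pow_half_mul_lt {c m L : ℝ} (hc1 : c < 1) (hm : 0 < m) (hL : 0 < L) :
    ∃ J : ℕ, (1 / 2 : ℝ) ^ J * L / (2 * m) < 1 - c := by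
  have h0 : 0 < (1 - c) * (2 * m) / L := by
    have : 0 < 1 - c := by linarith
    positivity
  obtain ⟨J, hJ⟩ := exists_pow_lt_of_lt_one h0 (show (1 / 2 : ℝ) < 1 by norm_num)
  refine ⟨J, ?_⟩
  rw [lt_div_iff₀ hL] at hJ
  rwa [div_lt_iff₀ (by positivity)]

variable (U : E ≃L[ℝ] (κ → ℝ)) (hU : ∀ ω i, U ω i = inner ℝ (e i) ω)
  (hθ : ∀ i, 0 < θ i ∧ θ i < 1) {d : E} (hd : ∀ i, dpsi (inner ℝ (e i) d) = θ i)
  {β c : ℝ} (hβ : 0 < β) (hc0 : 0 < c) (hc1 : c < 1)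

include hU hθ hd hβ hc0 hc1

/-- Runs of the limiting problem, started where the predicted reduction at `β ω₀` is small, have
uniformly bounded length; and for small `α` the step count after the reduction of `α` to `β α` is
that of such a run. The second assertion is a compactness argument: along an ultrafilter of values
of `α` with limit `0` the rescaled runs converge to a run of the limiting problem. -/
theorem exists_threshold_stepCount {Q : ℝ → ℝ} {T : ℝ → ι → ℝ} (hQ0 : ∀ α, 0 < α → 0 ≤ Q α)
    (hT0 : ∀ α, 0 < α → ∀ j, T α j ≤ 0) (hQ : Tendsto Q (𝓝[>] 0) (𝓝 0))
    (hT : ∀ j, Tendsto (fun α => T α j) (𝓝[>] 0) atBot) :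
    ∃ t₀ > 0, ∀ t, 0 < t → t < t₀ →
      (∃ M : ℕ, ∀ (ω₀ : E) (n : ℕ), predictedReduction (ridgeFun e θ b 0 0 0) (β • ω₀) ≤ t →
        StopsAfterTies (ridgeFun e θ b 0 0 0) c t ω₀ n → n ≤ M) ∧
      ∀ᶠ α in 𝓝[>] (0 : ℝ), ∀ ω : E,
        predictedReduction (ridgeFun e θ b (Q α) 1 (T α)) ω < t →
        ∃ n : ℕ, StopsAfter (ridgeFun e θ b (Q (β * α)) 1 (T (β * α))) c t (β⁻¹ • ω) n ∧
          ∃ ω₀ : E, predictedReduction (ridgeFun e θ b 0 0 0) (β • ω₀) ≤ t ∧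
            StopsAfterTies (ridgeFun e θ b 0 0 0) c t ω₀ n := by
  obtain ⟨t₀, ht₀, r, hr, hnear⟩ :=
    exists_norm_sub_lt_of_predictedReduction_lt (b := b) U hU hd
  obtain ⟨C, hC⟩ := exists_ridgeFun_le_of_start (e := e) (θ := θ) (b := b) d hβ
  obtain ⟨m, hm, hB⟩ := exists_newtonBounds (b := b) U hU hθ C
  have hL := curvBound_pos e b
  obtain ⟨J, hJ⟩ := exists_pow_half_mul_lt hc1 hm hL
  have hgrad0 : ridgeGrad e θ b 0 0 0 d = 0 := by simp [ridgeGrad, hd]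
  have hinv : ∀ ω : E, β • β⁻¹ • ω = ω := fun ω => by
    rw [smul_smul, mul_inv_cancel₀ hβ.ne', one_smul]
  refine ⟨t₀, ht₀, fun t ht htt => ⟨⟨⌊C / (c * (1 / 2) ^ J * t)⌋₊, ?_⟩, ?_⟩⟩
  · rintro ω₀ n hω₀ ⟨w, rfl, hs, -⟩
    refine (hB 0 0 0 le_rfl zero_le_one le_rfl zero_le_one).steps_le hm hL.le hc0 hJ ht ?_ hs
    refine (ridgeFun_le_ridgeFun_one zero_le_one zero_le_one (fun _ => le_rfl) _).trans (hC _ ?_)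
    exact hnear 0 0 0 le_rfl zero_le_one le_rfl zero_le_one (by rw [hgrad0, norm_zero]; exact hr.le)
      _ (hω₀.trans_lt htt)
  · have hβlim : Tendsto (fun α : ℝ => β * α) (𝓝[>] 0) (𝓝[>] 0) := by
      refine tendsto_nhdsWithin_iff.2 ⟨?_, ?_⟩
      · have : Tendsto (fun α : ℝ => β * α) (𝓝 0) (𝓝 (β * 0)) := by
          exact (continuous_const_mul β).tendsto 0
        rw [mul_zero] at this
        exact this.mono_left nhdsWithin_le_nhds
      · filter_upwards [self_mem_nhdsWithin] with α hα using mul_pos hβ hα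
    have hgood : ∀ᶠ α in 𝓝[>] (0 : ℝ), 0 < α ∧ Q α ≤ 1 ∧ Q (β * α) ≤ 1 ∧
        ‖ridgeGrad e θ b (Q α) 1 (T α) d‖ ≤ r := by
      have hg := (tendsto_ridgeGrad (e := e) (θ := θ) (b := b) hQ hT
        (tendsto_const_nhds (x := d)) 0).norm
      rw [hgrad0, norm_zero] at hg
      have hpos : ∀ᶠ α in 𝓝[>] (0 : ℝ), 0 < α := self_mem_nhdsWithin
      exact hpos.and ((hQ.eventually_le_const one_pos).and
        (((hQ.comp hβlim).eventually_le_const one_pos).and (hg.eventually_le_const hr)))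
    by_contra hcon
    have hfreq := (not_eventually.1 hcon).and_eventually hgood
    push Not at hfreq
    let A := {α : ℝ // (∃ ω : E, predictedReduction (ridgeFun e θ b (Q α) 1 (T α)) ω < t ∧
        ∀ n : ℕ, StopsAfter (ridgeFun e θ b (Q (β * α)) 1 (T (β * α))) c t (β⁻¹ • ω) n →
          ∀ ω₀ : E, predictedReduction (ridgeFun e θ b 0 0 0) (β • ω₀) ≤ t →
            ¬StopsAfterTies (ridgeFun e θ b 0 0 0) c t ω₀ n) ∧
      0 < α ∧ Q α ≤ 1 ∧ Q (β * α) ≤ 1 ∧ ‖ridgeGrad e θ b (Q α) 1 (T α) d‖ ≤ r}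
    have : (comap (Subtype.val : A → ℝ) (𝓝[>] 0)).NeBot := by
      rw [comap_neBot_iff_frequently]
      exact hfreq.mono fun α hα => ⟨⟨α, hα⟩, rfl⟩
    let l : Ultrafilter A := Ultrafilter.of (comap (Subtype.val : A → ℝ) (𝓝[>] 0))
    have hl : Tendsto (Subtype.val : A → ℝ) l (𝓝[>] 0) :=
      tendsto_comap.mono_left (Ultrafilter.of_le _)
    have hlβ : Tendsto (fun k : A => β * k.1) l (𝓝[>] 0) := hβlim.comp hl
    choose ω hω hno using fun k : A => k.2.1
    have hωd : ∀ k : A, ‖ω k - d‖ < 1 := fun k =>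
      hnear _ 1 _ (hQ0 _ k.2.2.1) k.2.2.2.1 zero_le_one le_rfl k.2.2.2.2.2 _ ((hω k).trans htt)
    obtain ⟨a, -, ha⟩ := (isCompact_closedBall d 1).ultrafilter_le_nhds (l.map ω) (by
      rw [Ultrafilter.coe_map, le_principal_iff]
      refine mem_map.2 (Eventually.of_forall fun k => ?_)
      rw [mem_closedBall_iff_norm]
      exact (hωd k).le)
    have hωa : Tendsto ω l (𝓝 a) := ha
    have hBk : ∀ k : A, NewtonBounds (ridgeFun e θ b (Q (β * k.1)) 1 (T (β * k.1)))
        (ridgeGrad e θ b (Q (β * k.1)) 1 (T (β * k.1)))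
        (ridgeHess e b (Q (β * k.1)) 1 (T (β * k.1))) C m (curvBound e b) := fun k =>
      hB _ 1 _ (hQ0 _ (mul_pos hβ k.2.2.1)) k.2.2.2.2.1 zero_le_one le_rfl
    have hstart : ∀ k : A,
        ridgeFun e θ b (Q (β * k.1)) 1 (T (β * k.1)) (β⁻¹ • ω k) ≤ C := fun k =>
      (ridgeFun_le_ridgeFun_one k.2.2.2.2.1 le_rfl (hT0 _ (mul_pos hβ k.2.2.1)) _).trans
        (hC _ (by rw [hinv]; exact hωd k))
    choose n hn using fun k : A => (hBk k).exists_stopsAfter hm hL.le hc0 hJ ht (hstart k)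
    choose w hw0 hstep hend using hn
    have hQl : Tendsto (fun k : A => Q (β * k.1)) l (𝓝 0) := hQ.comp hlβ
    have hTl : ∀ j, Tendsto (fun k : A => T (β * k.1) j) l atBot := fun j => (hT j).comp hlβ
    have hQl0 : ∀ᶠ k : A in l, 0 ≤ Q (β * k.1) :=
      Eventually.of_forall fun k => hQ0 _ (mul_pos hβ k.2.2.1)
    have hties : ∀ k : A, ∀ i < n k,
        t ≤ predictedReduction (ridgeFun e θ b (Q (β * k.1)) 1 (T (β * k.1))) (w k i) ∧
        IsGuardedStepTies (ridgeFun e θ b (Q (β * k.1)) 1 (T (β * k.1))) c (w k i) (w k (i + 1)) :=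
      fun k i hi => ⟨(hstep k i hi).1, (hstep k i hi).2.ties⟩
    have hC' : ∀ k, ridgeFun e θ b (Q (β * k.1)) 1 (T (β * k.1)) (w k 0) ≤ C := fun k => by
      rw [hw0]; exact hstart k
    have hlim0 : Tendsto (fun k => w k 0) l (𝓝 (β⁻¹ • a)) := by
      simp only [hw0]
      exact hωa.const_smul _
    obtain ⟨N₀, hN₀, hrun⟩ := exists_stopsAfterTies_of_tendsto
      (F := fun k : A => ridgeFun e θ b (Q (β * k.1)) 1 (T (β * k.1)))
      (f := ridgeFun e θ b 0 0 0) (c := c) (tol := t) (J := J)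
      (M := ⌊C / (c * (1 / 2) ^ J * t)⌋₊) (l := l)
      (fun ω' p hp => tendsto_newtonDir U hU hQl hTl hp hQl0 hθ 0)
      (fun ω' p hp => tendsto_predictedReduction U hU hQl hTl hp hQl0 hθ 0)
      (fun ω' p j hp => tendsto_trialValue_sub_armijoBound U hU hQl hTl hp hQl0 hθ c j 0)
      (Eventually.of_forall fun k => (hBk k).steps_le hm hL.le hc0 hJ ht (hC' k) (hties k))
      (fun k i hi => by
        refine ⟨(hstep k i hi).1, ?_⟩
        obtain ⟨j, h1, h2, h3⟩ := (hties k i hi).2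
        have hdec := (hBk k).apply_le_along hm hL.le hc0 hJ ht (hC' k) (hties k) hi.le
        have h0 : 0 ≤ i * (c * (1 / 2 : ℝ) ^ J * t) := by positivity
        exact ⟨j, (hBk k).exponent_le hm hL.le (by linarith [hC' k]) hJ
          (ht.trans_le (hstep k i hi).1) h2, h1, h2, h3⟩)
      hend hlim0
    obtain ⟨k, hk⟩ := hN₀.exists
    refine hno k (n k) ⟨w k, hw0 k, hstep k, hend k⟩ (β⁻¹ • a) ?_ (hk ▸ hrun)
    rw [hinv]
    exact le_of_tendsto (tendsto_predictedReduction U hU (hQ.comp hl)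
      (fun j => (hT j).comp hl) hωa (Eventually.of_forall fun k => hQ0 _ k.2.2.1) hθ 0)
      (Eventually.of_forall fun k => (hω k).le)

end Count

/-! ### The limiting problem in coordinates -/

section Coordinates

variable {κ : Type*} [Fintype κ]

/-- A Newton step of length `s` for the limiting problem, in the coordinates `uᵢ = ⟪eᵢ, ω⟫`, in
which the problem is separable. -/
noncomputable def coordStep (θ : κ → ℝ) (s : ℝ) (u : κ → ℝ) : κ → ℝ :=
  fun i => u i - s * scalarNewton (θ i) (u i)

/-- Left-hand minus right-hand side of the Armijo test for step length `s`, in coordinates. -/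
noncomputable def coordGap (θ : κ → ℝ) (c s : ℝ) (u : κ → ℝ) : ℝ :=
  ∑ i, scalarGap (θ i) c s (u i)

/-- The predicted reduction in coordinates. -/
noncomputable def coordRed (θ : κ → ℝ) (u : κ → ℝ) : ℝ := ∑ i, scalarResidual (θ i) (u i) ^ 2

/-- A guarded step in coordinates; Armijo tests that hold with equality may be decided
either way. -/
def CoordTiesStep (θ : κ → ℝ) (c : ℝ) (u u' : κ → ℝ) : Prop :=
  ∃ j : ℕ, coordGap θ c ((1 / 2) ^ j) u ≤ 0 ∧ (∀ i < j, 0 ≤ coordGap θ c ((1 / 2) ^ i) u) ∧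
    u' = coordStep θ ((1 / 2) ^ j) u

lemma continuous_coordGap (θ : κ → ℝ) (c s : ℝ) : Continuous (coordGap θ c s) := by
  unfold coordGap; fun_prop

lemma continuous_coordRed (θ : κ → ℝ) : Continuous (coordRed θ) := by
  unfold coordRed; fun_prop

lemma CoordTiesStep.eq_of_strict {θ : κ → ℝ} {c : ℝ} {u u' : κ → ℝ} {j : ℕ}
    (h : CoordTiesStep θ c u u') (h1 : coordGap θ c ((1 / 2) ^ j) u < 0)
    (h2 : ∀ i < j, 0 < coordGap θ c ((1 / 2) ^ i) u) : u' = coordStep θ ((1 / 2) ^ j) u := by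
  obtain ⟨j', h1', h2', rfl⟩ := h
  rcases lt_trichotomy j' j with h | h | h
  · exact absurd h1' (not_le.2 (h2 j' h))
  · rw [h]
  · exact absurd h1 (not_lt.2 (h2' j h))

variable {θ D : κ → ℝ} (hD : ∀ i, dpsi (D i) = θ i)

lemma abs_apply_sub_le_norm (u v : κ → ℝ) (i : κ) : |u i - v i| ≤ ‖u - v‖ := by
  simpa using norm_le_pi_norm (u - v) i

lemma eventually_forall_abs_sub_le {P : ℝ → Prop} {a : ℝ} (h : ∀ᶠ u in 𝓝 a, P u) :
    ∀ᶠ r in 𝓝[>] (0 : ℝ), ∀ u, |u - a| ≤ r → P u := by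
  obtain ⟨ρ, hρ, H⟩ := Metric.eventually_nhds_iff.1 h
  filter_upwards [Ioo_mem_nhdsGT hρ] with r hr u hu
  exact H (by rw [Real.dist_eq]; exact hu.trans_lt hr.2)

include hD

lemma coordStep_self (s : ℝ) : coordStep θ s D = D := by
  funext i
  simp [coordStep, scalarNewton_self (hD i)]

lemma coordRed_self : coordRed θ D = 0 := by
  simp [coordRed, scalarResidual, hD]

lemma eventually_coordGap_neg {c s : ℝ} (hs : 0 < s) (h : s < 2 * (1 - c)) :
    ∀ᶠ r in 𝓝[>] (0 : ℝ), ∀ u, ‖u - D‖ ≤ r → u ≠ D → coordGap θ c s u < 0 := by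
  have := eventually_all.2 fun i =>
    eventually_forall_abs_sub_le (eventually_scalarGap_neg (hD i) hs h)
  filter_upwards [this] with r hr u hu hne
  obtain ⟨i, hi⟩ := Function.ne_iff.1 hne
  have h1 : ∀ i, u i ≠ D i → scalarGap (θ i) c s (u i) < 0 := fun i =>
    hr i _ ((abs_apply_sub_le_norm u D i).trans hu)
  refine Finset.sum_neg' (fun i _ => ?_) ⟨i, Finset.mem_univ i, h1 i hi⟩
  by_cases hi' : u i = D i
  · rw [hi', scalarGap_self (hD i)]
  · exact (h1 i hi').le

lemma eventually_coordGap_pos {c s : ℝ} (hs : 0 < s) (h : 2 * (1 - c) < s) :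
    ∀ᶠ r in 𝓝[>] (0 : ℝ), ∀ u, ‖u - D‖ ≤ r → u ≠ D → 0 < coordGap θ c s u := by
  have := eventually_all.2 fun i =>
    eventually_forall_abs_sub_le (eventually_scalarGap_pos (hD i) hs h)
  filter_upwards [this] with r hr u hu hne
  obtain ⟨i, hi⟩ := Function.ne_iff.1 hne
  have h1 : ∀ i, u i ≠ D i → 0 < scalarGap (θ i) c s (u i) := fun i =>
    hr i _ ((abs_apply_sub_le_norm u D i).trans hu)
  refine Finset.sum_pos' (fun i _ => ?_) ⟨i, Finset.mem_univ i, h1 i hi⟩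
  by_cases hi' : u i = D i
  · rw [hi', scalarGap_self (hD i)]
  · exact (h1 i hi').le

/-- A Newton step of fixed length `s` has derivative `(1 - s)` times the identity at the
minimizer. -/
lemma eventually_coordStep_contract {s K : ℝ} (hK : |1 - s| < K) :
    ∀ᶠ r in 𝓝[>] (0 : ℝ), ∀ u v, ‖u - D‖ ≤ r → ‖v - D‖ ≤ r →
      ‖coordStep θ s u - coordStep θ s v‖ ≤ K * ‖u - v‖ := by
  have hK0 : 0 ≤ K := (abs_nonneg _).trans hK.le
  have h1 : ∀ i, ContDiff ℝ 1 fun x => x - s * scalarNewton (θ i) x := fun i =>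
    contDiff_id.sub (contDiff_const.mul (contDiff_scalarNewton (θ i)))
  have h2 : ∀ i, HasDerivAt (fun x => x - s * scalarNewton (θ i) x) (1 - s) (D i) := fun i => by
    have := (hasDerivAt_id (D i)).sub ((hasDerivAt_scalarNewton (hD i)).const_mul s)
    rwa [mul_one] at this
  filter_upwards [eventually_all.2 fun i => eventually_abs_sub_le (h1 i) (h2 i) hK]
    with r hr u v hu hv
  rw [pi_norm_le_iff_of_nonneg (by positivity)]
  intro i
  refine (hr i (u i) (v i) ((abs_apply_sub_le_norm u D i).trans hu)
    ((abs_apply_sub_le_norm v D i).trans hv)).trans ?_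
  gcongr
  exact abs_apply_sub_le_norm u v i

omit hD in
lemma exists_lipschitz_coordStep (θ : κ → ℝ) (s : ℝ) (p : κ → ℝ) :
    ∃ K ≥ 0, ∀ᶠ r in 𝓝[>] (0 : ℝ), ∀ u, ‖u - p‖ ≤ r →
      ‖coordStep θ s u - coordStep θ s p‖ ≤ K * ‖u - p‖ := by
  have h1 : ∀ i, ContDiff ℝ 1 fun x => x - s * scalarNewton (θ i) x := fun i =>
    contDiff_id.sub (contDiff_const.mul (contDiff_scalarNewton (θ i)))
  have h2 : ∀ i, ∃ K, |deriv (fun x => x - s * scalarNewton (θ i) x) (p i)| < K := fun i =>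
    ⟨_, lt_add_one _⟩
  choose K hK using h2
  have hK0 : ∀ i, 0 ≤ K i := fun i => (abs_nonneg _).trans (hK i).le
  refine ⟨∑ i, K i, Finset.sum_nonneg fun i _ => hK0 i, ?_⟩
  filter_upwards [eventually_all.2 fun i => eventually_abs_sub_le (h1 i)
    (((h1 i).differentiable one_ne_zero) (p i)).hasDerivAt (hK i), self_mem_nhdsWithin]
    with r hr hr0 u hu
  rw [pi_norm_le_iff_of_nonneg (mul_nonneg (Finset.sum_nonneg fun i _ => hK0 i) (norm_nonneg _))]
  intro i
  refine (hr i (u i) (p i) ((abs_apply_sub_le_norm u p i).trans hu)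
    (by simpa using (le_of_lt hr0 : (0 : ℝ) ≤ r))).trans ?_
  have := abs_apply_sub_le_norm u p i
  have h3 : K i ≤ ∑ i, K i := Finset.single_le_sum (fun i _ => hK0 i) (Finset.mem_univ i)
  have h4 : 0 ≤ ∑ i, K i := (hK0 i).trans h3
  gcongr

omit hD in
lemma add_sq_le_mul_sq_add {a e ξ : ℝ} (hξ : 0 < ξ) :
    (a + e) ^ 2 ≤ (1 + ξ) * a ^ 2 + (1 + 1 / ξ) * e ^ 2 := by
  have h : (1 + ξ) * a ^ 2 + (1 + 1 / ξ) * e ^ 2 - (a + e) ^ 2 = (ξ * a - e) ^ 2 / ξ := by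
    field_simp
    ring
  have : 0 ≤ (ξ * a - e) ^ 2 / ξ := by positivity
  linarith

omit hD in
/-- The square root of the predicted reduction is Lipschitz near every point, here in the form of a
comparison of predicted reductions. -/
lemma exists_coordRed_le (θ D : κ → ℝ) :
    ∃ B > 0, ∀ᶠ r in 𝓝[>] (0 : ℝ), ∀ u v, ‖u - D‖ ≤ r → ‖v - D‖ ≤ r → ∀ ξ > 0,
      coordRed θ u ≤ (1 + ξ) * coordRed θ v + (1 + 1 / ξ) * (B * ‖u - v‖ ^ 2) := by
  have h2 : ∀ i, ∃ K, |deriv (scalarResidual (θ i)) (D i)| < K := fun i => ⟨_, lt_add_one _⟩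
  choose K hK using h2
  refine ⟨∑ i, K i ^ 2 + 1, by positivity, ?_⟩
  filter_upwards [eventually_all.2 fun i => eventually_abs_sub_le (contDiff_scalarResidual (θ i))
    (((contDiff_scalarResidual (θ i)).differentiable one_ne_zero) (D i)).hasDerivAt (hK i)]
    with r hr u v hu hv ξ hξ
  have h1 : coordRed θ u ≤ ∑ i, ((1 + ξ) * scalarResidual (θ i) (v i) ^ 2
      + (1 + 1 / ξ) * (K i ^ 2 * ‖u - v‖ ^ 2)) := by
    refine Finset.sum_le_sum fun i _ => ?_
    have h3 := hr i (u i) (v i) ((abs_apply_sub_le_norm u D i).trans hu)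
      ((abs_apply_sub_le_norm v D i).trans hv)
    have h4 := add_sq_le_mul_sq_add (a := scalarResidual (θ i) (v i))
      (e := scalarResidual (θ i) (u i) - scalarResidual (θ i) (v i)) hξ
    rw [add_sub_cancel] at h4
    refine h4.trans ?_
    have h5 : (scalarResidual (θ i) (u i) - scalarResidual (θ i) (v i)) ^ 2
        ≤ K i ^ 2 * ‖u - v‖ ^ 2 := by
      rw [← sq_abs, ← mul_pow]
      have := abs_apply_sub_le_norm u v i
      have hK0 : 0 ≤ K i := (abs_nonneg _).trans (hK i).le
      gcongr
      exact h3.trans (by gcongr)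
    gcongr
  rw [Finset.sum_add_distrib, ← Finset.mul_sum, ← Finset.mul_sum, ← Finset.sum_mul] at h1
  have h6 : (∑ i, K i ^ 2) * ‖u - v‖ ^ 2 ≤ (∑ i, K i ^ 2 + 1) * ‖u - v‖ ^ 2 := by
    gcongr; linarith
  have h7 : (1 + 1 / ξ) * ((∑ i, K i ^ 2) * ‖u - v‖ ^ 2) ≤
      (1 + 1 / ξ) * ((∑ i, K i ^ 2 + 1) * ‖u - v‖ ^ 2) := by gcongr
  exact h1.trans (by rw [coordRed]; linarith)

lemma exists_le_coordRed :
    ∃ a > 0, ∀ u, (a * min 1 ‖u - D‖) ^ 2 ≤ coordRed θ u := by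
  choose c hc hcle using fun i => exists_mul_min_le_abs_dpsi_sub (D i)
  obtain ⟨t, ht, hT⟩ := exists_forall_le_of_pos hc
  refine ⟨t, ht, fun u => ?_⟩
  rcases isEmpty_or_nonempty κ with hκ | hκ
  · have : u - D = 0 := Subsingleton.elim _ _
    simp [this, coordRed]
  · obtain ⟨i, hi⟩ := Finite.exists_max fun i => |u i - D i|
    have h1 : ‖u - D‖ ≤ |u i - D i| :=
      (pi_norm_le_iff_of_nonneg (abs_nonneg _)).2 fun k => by simpa using hi k
    have h2 : scalarResidual (θ i) (u i) ^ 2 ≤ coordRed θ u :=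
      Finset.single_le_sum (f := fun i => scalarResidual (θ i) (u i) ^ 2)
        (fun i _ => sq_nonneg _) (Finset.mem_univ i)
    refine le_trans ?_ h2
    have h3 : (dpsi (u i) - θ i) ^ 2 ≤ scalarResidual (θ i) (u i) ^ 2 := by
      rw [scalarResidual, div_pow, Real.sq_sqrt (ddpsi_pos _).le, le_div_iff₀ (ddpsi_pos _)]
      have := ddpsi_le (u i)
      nlinarith [sq_nonneg (dpsi (u i) - θ i)]
    refine le_trans ?_ h3
    rw [← sq_abs (dpsi (u i) - θ i), ← hD i]
    have h4 := hcle i (u i)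
    have h5 : t * min 1 ‖u - D‖ ≤ c i * min 1 |u i - D i| := by
      have := (hc i).le
      gcongr
      exact hT i
    have h6 : 0 ≤ min 1 ‖u - D‖ := le_min zero_le_one (norm_nonneg _)
    gcongr
    exact h5.trans h4

lemma coordRed_pos {u : κ → ℝ} (hu : u ≠ D) : 0 < coordRed θ u := by
  obtain ⟨a, ha, h⟩ := exists_le_coordRed hD
  refine lt_of_lt_of_le ?_ (h u)
  have : 0 < ‖u - D‖ := norm_pos_iff.2 (sub_ne_zero.2 hu)
  positivity

omit hD in
/-- Without ties in the limit, backtracking near the minimizer always ends at the same exponent. -/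
lemma exists_exponent {c : ℝ} (hc1 : c < 1) (htie : ∀ j : ℕ, c ≠ 1 - (1 / 2 : ℝ) ^ (j + 1)) :
    ∃ j : ℕ, (1 / 2 : ℝ) ^ j < 2 * (1 - c) ∧ (∀ i < j, 2 * (1 - c) < (1 / 2 : ℝ) ^ i) ∧
      (c < 1 / 2 → j = 0) := by
  classical
  have hex : ∃ j : ℕ, (1 / 2 : ℝ) ^ j < 2 * (1 - c) :=
    exists_pow_lt_of_lt_one (by linarith) (by norm_num)
  refine ⟨Nat.find hex, Nat.find_spec hex, fun i hi => ?_, fun h => ?_⟩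
  · refine lt_of_le_of_ne (not_lt.1 (Nat.find_min hex hi)) fun heq => htie i ?_
    rw [pow_succ, ← heq]; ring
  · rw [Nat.find_eq_zero]
    rw [pow_zero]; linarith

/-- A run without ties is stable under perturbations of its starting point over any fixed number
of steps, with an error proportional to the perturbation. -/
lemma exists_error_bound {c A : ℝ} {u : ℕ → κ → ℝ}
    (hstrict : ∀ k, ∃ j : ℕ, coordGap θ c ((1 / 2) ^ j) (u k) < 0 ∧
      (∀ i < j, 0 < coordGap θ c ((1 / 2) ^ i) (u k)) ∧ u (k + 1) = coordStep θ ((1 / 2) ^ j) (u k))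
    (hne : ∀ k, u k ≠ D) (k : ℕ) :
    ∃ A' ≥ 0, ∀ᶠ t in 𝓝[>] (0 : ℝ), ∀ (v : ℕ → κ → ℝ) (n : ℕ), ‖v 0 - u 0‖ ≤ A * √t →
      (∀ i < n, t ≤ coordRed θ (v i) ∧ CoordTiesStep θ c (v i) (v (i + 1))) →
      coordRed θ (v n) ≤ t → k ≤ n ∧ ‖v k - u k‖ ≤ A' * √t := by
  induction k with
  | zero =>
    refine ⟨max A 0, le_max_right _ _, Eventually.of_forall fun t v n h0 _ _ =>
      ⟨Nat.zero_le _, h0.trans ?_⟩⟩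
    gcongr
    exact le_max_left _ _
  | succ k ih =>
    obtain ⟨A', hA', hev⟩ := ih
    obtain ⟨j, hj1, hj2, hj3⟩ := hstrict k
    obtain ⟨K, hK, hLip⟩ := exists_lipschitz_coordStep θ ((1 / 2) ^ j) (u k)
    have hred := coordRed_pos hD (hne k)
    have hnhds : ∀ᶠ v in 𝓝 (u k), coordRed θ (u k) / 2 < coordRed θ v ∧
        coordGap θ c ((1 / 2) ^ j) v < 0 ∧ ∀ i < j, 0 < coordGap θ c ((1 / 2) ^ i) v := by
      refine (((continuous_coordRed θ).tendsto (u k)).eventually_const_lt (by linarith)).and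
        ((((continuous_coordGap θ c _).tendsto (u k)).eventually_lt_const hj1).and ?_)
      have := (Set.finite_Iio j).eventually_all (l := 𝓝 (u k))
        (p := fun i v => 0 < coordGap θ c ((1 / 2) ^ i) v)
      exact this.2 fun i hi =>
        ((continuous_coordGap θ c _).tendsto (u k)).eventually_const_lt (hj2 i hi)
    obtain ⟨ρ, hρ, hball⟩ := Metric.eventually_nhds_iff.1 hnhds
    obtain ⟨r, hr, hr0, hrρ⟩ := (hLip.and (Ioo_mem_nhdsGT hρ)).exists
    have hsqrt : Tendsto (fun t : ℝ => A' * √t) (𝓝[>] 0) (𝓝 0) := by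
      have : Tendsto (fun t : ℝ => A' * √t) (𝓝 0) (𝓝 (A' * √0)) :=
        (continuous_const.mul Real.continuous_sqrt).tendsto 0
      rw [Real.sqrt_zero, mul_zero] at this
      exact this.mono_left nhdsWithin_le_nhds
    refine ⟨K * A', by positivity, ?_⟩
    filter_upwards [hev, hsqrt.eventually_le_const hr0,
      Ioo_mem_nhdsGT (show 0 < coordRed θ (u k) / 2 by linarith)] with t ht htr htt v n h0 hs hn
    obtain ⟨hkn, hvk⟩ := ht v n h0 hs hn
    obtain ⟨hb1, hb2, hb3⟩ := hball (y := v k) (by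
      rw [dist_eq_norm]; exact (hvk.trans htr).trans_lt hrρ)
    have hlt : k < n := by
      refine lt_of_le_of_ne hkn fun heq => ?_
      rw [← heq] at hn
      linarith [htt.2]
    refine ⟨hlt, ?_⟩
    rw [(hs k hlt).2.eq_of_strict hb2 hb3, hj3, mul_assoc]
    refine (hr (v k) (hvk.trans htr)).trans ?_
    gcongr

/-- Step counts in coordinates. For a run `u` without ties that tends to the minimizer, every run
that starts within `O(√t)` of `u 0` reaches predicted reduction `t` at a step between those at which
`u` falls below `(1 + ε) t` and `(1 - ε) t`. Near the minimizer all runs use the same step length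
and the step map is a contraction; as the number of steps grows when `t → 0`, the initial error is
damped until it is small compared with `√t`. -/
theorem eventually_coord_stepCount {c A ε : ℝ} (hc0 : 0 < c) (hc1 : c < 1)
    (htie : ∀ j : ℕ, c ≠ 1 - (1 / 2 : ℝ) ^ (j + 1)) (hε0 : 0 < ε) (hε1 : ε < 1)
    {u : ℕ → κ → ℝ}
    (hstrict : ∀ k, ∃ j : ℕ, coordGap θ c ((1 / 2) ^ j) (u k) < 0 ∧
      (∀ i < j, 0 < coordGap θ c ((1 / 2) ^ i) (u k)) ∧ u (k + 1) = coordStep θ ((1 / 2) ^ j) (u k))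
    (hne : ∀ k, u k ≠ D) (hconv : ∀ ρ > 0, ∃ k, ‖u k - D‖ < ρ) :
    ∀ᶠ t in 𝓝[>] (0 : ℝ), ∃ n₁ n₂ : ℕ,
      ((∀ k < n₁, (1 + ε) * t ≤ coordRed θ (u k)) ∧ coordRed θ (u n₁) < (1 + ε) * t) ∧
      ((∀ k < n₂, (1 - ε) * t ≤ coordRed θ (u k)) ∧ coordRed θ (u n₂) < (1 - ε) * t) ∧
      (c < 1 / 2 → n₂ ≤ n₁ + 1) ∧
      ∀ (v : ℕ → κ → ℝ) (n : ℕ), ‖v 0 - u 0‖ ≤ A * √t →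
        (∀ i < n, t ≤ coordRed θ (v i) ∧ CoordTiesStep θ c (v i) (v (i + 1))) →
        coordRed θ (v n) ≤ t → n₁ ≤ n ∧ n ≤ n₂ := by
  classical
  obtain ⟨j, hj1, hj2, hj3⟩ := exists_exponent hc1 htie
  obtain ⟨B, hB, hBev⟩ := exists_coordRed_le θ D
  obtain ⟨a, ha, hale⟩ := exists_le_coordRed hD
  have hs0 : (0 : ℝ) < (1 / 2) ^ j := by positivity
  have hs1 : (1 / 2 : ℝ) ^ j ≤ 1 := pow_le_one₀ (by norm_num) (by norm_num)
  -- for full steps the contraction factor can be taken as small as the last claim requires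
  obtain ⟨K, hK, hK1, hKε⟩ : ∃ K : ℝ, |1 - (1 / 2 : ℝ) ^ j| < K ∧ K < 1 ∧
      (j = 0 → 2 * (B * K ^ 2) * (1 + ε) ≤ (1 - ε) * a ^ 2) := by
    by_cases hj0 : j = 0
    · have h1 : Tendsto (fun K : ℝ => 2 * (B * K ^ 2) * (1 + ε)) (𝓝[>] 0) (𝓝 0) := by
        have : Continuous fun K : ℝ => 2 * (B * K ^ 2) * (1 + ε) := by fun_prop
        have := this.tendsto 0
        simp only [ne_eq, OfNat.ofNat_ne_zero, not_false_eq_true, zero_pow, mul_zero,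
          zero_mul] at this
        exact this.mono_left nhdsWithin_le_nhds
      have h2 : 0 < (1 - ε) * a ^ 2 := mul_pos (by linarith) (by positivity)
      obtain ⟨K, hK1, hK2⟩ := ((h1.eventually_le_const h2).and
        (Ioo_mem_nhdsGT (zero_lt_one' ℝ))).exists
      refine ⟨K, ?_, hK2.2, fun _ => hK1⟩
      rw [hj0]; simpa using hK2.1
    · refine ⟨1 - (1 / 2 : ℝ) ^ j / 2, ?_, by linarith, fun h => absurd h hj0⟩
      rw [abs_of_nonneg (by linarith)]; linarith
  have hK0 : 0 ≤ K := (abs_nonneg _).trans hK.le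
  obtain ⟨ρ, ⟨⟨hneg, hpos⟩, hcon, hRed⟩, hρ0, hρ1⟩ :=
    (((eventually_coordGap_neg hD hs0 hj1).and
      ((Set.finite_Iio j).eventually_all.2 fun i hi =>
        eventually_coordGap_pos hD (show (0 : ℝ) < (1 / 2) ^ i by positivity) (hj2 i hi))).and
      ((eventually_coordStep_contract hD hK).and hBev)).and
      (Ioo_mem_nhdsGT (zero_lt_one' ℝ)) |>.exists
  have hDρ : ‖D - D‖ ≤ ρ := by simpa using hρ0.le
  -- the step taken near the minimizer
  have hstep : ∀ x x' : κ → ℝ, ‖x - D‖ ≤ ρ → x ≠ D → CoordTiesStep θ c x x' →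
      x' = coordStep θ ((1 / 2) ^ j) x := fun x x' hx hxD h =>
    h.eq_of_strict (hneg x hx hxD) fun i hi => hpos i hi x hx hxD
  have hties : ∀ k, CoordTiesStep θ c (u k) (u (k + 1)) := fun k => by
    obtain ⟨i, h1, h2, h3⟩ := hstrict k
    exact ⟨i, h1.le, fun i' hi' => (h2 i' hi').le, h3⟩
  obtain ⟨k₀, hk₀⟩ := hconv (ρ / 2) (by linarith)
  have hudecay : ∀ l, ‖u (k₀ + l) - D‖ ≤ K ^ l * (ρ / 2) := by
    intro l
    induction l with
    | zero => simpa using hk₀.le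
    | succ l ih =>
      have h1 : ‖u (k₀ + l) - D‖ ≤ ρ := by
        refine ih.trans ?_
        have := mul_le_mul_of_nonneg_right (pow_le_one₀ hK0 hK1.le (n := l))
          (show 0 ≤ ρ / 2 by linarith)
        linarith
      have h2 := hcon _ D h1 hDρ
      rw [coordStep_self hD, ← hstep _ _ h1 (hne _) (hties (k₀ + l))] at h2
      calc ‖u (k₀ + (l + 1)) - D‖ ≤ K * ‖u (k₀ + l) - D‖ := h2
        _ ≤ K * (K ^ l * (ρ / 2)) := by gcongr
        _ = K ^ (l + 1) * (ρ / 2) := by ring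
  have huball : ∀ k, k₀ ≤ k → ‖u k - D‖ ≤ ρ / 2 := by
    intro k hk
    obtain ⟨l, rfl⟩ := Nat.exists_eq_add_of_le hk
    refine (hudecay l).trans ?_
    have := mul_le_mul_of_nonneg_right (pow_le_one₀ hK0 hK1.le (n := l))
      (show 0 ≤ ρ / 2 by linarith)
    linarith
  have hutend : Tendsto (fun l => u (k₀ + l)) atTop (𝓝 D) := by
    rw [tendsto_iff_norm_sub_tendsto_zero]
    refine squeeze_zero (fun l => norm_nonneg _) hudecay ?_
    simpa using (tendsto_pow_atTop_nhds_zero_of_lt_one hK0 hK1).mul_const (ρ / 2)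
  have hsmall : ∀ x > 0, ∃ k, coordRed θ (u k) < x := by
    intro x hx
    have := ((continuous_coordRed θ).tendsto D).comp hutend
    rw [coordRed_self hD] at this
    obtain ⟨l, hl⟩ := (this.eventually_lt_const hx).exists
    exact ⟨k₀ + l, hl⟩
  obtain ⟨A', hA', hevA'⟩ := exists_error_bound (A := A) hD hstrict hne k₀
  -- after `l` further steps the error has become small
  obtain ⟨l, hl⟩ : ∃ l : ℕ, (1 + 1 / (ε / 2)) * (B * (K ^ l * A') ^ 2) ≤ ε / 4 := by
    have h1 : Tendsto (fun l : ℕ => (1 + 1 / (ε / 2)) * (B * (K ^ l * A') ^ 2)) atTop (𝓝 0) := by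
      have := ((((tendsto_pow_atTop_nhds_zero_of_lt_one hK0 hK1).mul_const A').pow 2).const_mul
        B).const_mul (1 + 1 / (ε / 2))
      simpa using this
    exact (h1.eventually_le_const (by linarith)).exists
  obtain ⟨A'', -, hevA''⟩ := exists_error_bound (A := A) hD hstrict hne (k₀ + l)
  have hsqrt : Tendsto (fun t : ℝ => A' * √t) (𝓝[>] 0) (𝓝 0) := by
    have : Tendsto (fun t : ℝ => A' * √t) (𝓝 0) (𝓝 (A' * √0)) :=
      (continuous_const.mul Real.continuous_sqrt).tendsto 0
    rw [Real.sqrt_zero, mul_zero] at this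
    exact this.mono_left nhdsWithin_le_nhds
  have hlarge : ∀ᶠ t in 𝓝[>] (0 : ℝ), ∀ k ≤ k₀ + l, (1 + ε) * t ≤ coordRed θ (u k) := by
    refine (Set.finite_Iic (k₀ + l)).eventually_all.2 fun k _ => ?_
    have : 0 < coordRed θ (u k) / (1 + ε) := div_pos (coordRed_pos hD (hne k)) (by linarith)
    filter_upwards [Ioo_mem_nhdsGT this] with t ht
    have := ht.2
    rw [lt_div_iff₀ (by linarith)] at this
    linarith
  filter_upwards [hevA', hevA'', hlarge, hsqrt.eventually_le_const (show 0 < ρ / 2 by linarith),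
    self_mem_nhdsWithin] with t ht1 ht2 ht3 ht4 (ht0 : 0 < t)
  have hp : 0 < (1 + ε) * t := by positivity
  have hm : 0 < (1 - ε) * t := mul_pos (by linarith) ht0
  have hmp : (1 - ε) * t ≤ (1 + ε) * t := by gcongr; linarith
  have hex1 := hsmall _ hp
  have hex2 := hsmall _ hm
  set n₁ := Nat.find hex1 with hn₁
  set n₂ := Nat.find hex2 with hn₂
  have hn₁s : coordRed θ (u n₁) < (1 + ε) * t := Nat.find_spec hex1
  have hn₂s : coordRed θ (u n₂) < (1 - ε) * t := Nat.find_spec hex2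
  have hn₁m : ∀ k < n₁, (1 + ε) * t ≤ coordRed θ (u k) := fun k hk =>
    not_lt.1 (Nat.find_min hex1 hk)
  have hn₂m : ∀ k < n₂, (1 - ε) * t ≤ coordRed θ (u k) := fun k hk =>
    not_lt.1 (Nat.find_min hex2 hk)
  have hlt1 : k₀ + l < n₁ := by
    by_contra hle
    exact absurd hn₁s (not_lt.2 (ht3 n₁ (not_lt.1 hle)))
  have hlt2 : k₀ + l < n₂ := by
    by_contra hle
    exact absurd hn₂s (not_lt.2 (hmp.trans (ht3 n₂ (not_lt.1 hle))))
  refine ⟨n₁, n₂, ⟨hn₁m, hn₁s⟩, ⟨hn₂m, hn₂s⟩, fun hc => ?_, fun v n h0 hs hn => ?_⟩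
  · refine Nat.find_min' hex2 ?_
    have hj0 := hj3 hc
    have h1 : ‖u n₁ - D‖ ≤ ρ := (huball n₁ (by omega)).trans (by linarith)
    have h2 := hcon _ D h1 hDρ
    rw [coordStep_self hD, ← hstep _ _ h1 (hne _) (hties n₁)] at h2
    have h3 := hRed (u (n₁ + 1)) D ((huball (n₁ + 1) (by omega)).trans (by linarith)) hDρ 1 one_pos
    rw [coordRed_self hD] at h3
    have h4 := hale (u n₁)
    rw [min_eq_right (h1.trans hρ1.le)] at h4
    have h5 : coordRed θ (u (n₁ + 1)) ≤ 2 * (B * K ^ 2) * ‖u n₁ - D‖ ^ 2 := by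
      calc coordRed θ (u (n₁ + 1)) ≤ 2 * (B * ‖u (n₁ + 1) - D‖ ^ 2) := by linarith
        _ ≤ 2 * (B * (K * ‖u n₁ - D‖) ^ 2) := by gcongr
        _ = _ := by ring
    have ha2 : 0 < a ^ 2 := by positivity
    refine lt_of_mul_lt_mul_right ?_ ha2.le
    calc coordRed θ (u (n₁ + 1)) * a ^ 2 ≤ 2 * (B * K ^ 2) * ‖u n₁ - D‖ ^ 2 * a ^ 2 := by gcongr
      _ = 2 * (B * K ^ 2) * (a * ‖u n₁ - D‖) ^ 2 := by ring
      _ ≤ 2 * (B * K ^ 2) * coordRed θ (u n₁) := by gcongr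
      _ ≤ (1 - ε) * a ^ 2 / (1 + ε) * coordRed θ (u n₁) := by
        have hpos' := coordRed_pos hD (hne n₁)
        gcongr
        rw [le_div_iff₀ (by linarith)]
        exact hKε hj0
      _ < (1 - ε) * a ^ 2 / (1 + ε) * ((1 + ε) * t) := by
        have : 0 < (1 - ε) * a ^ 2 / (1 + ε) :=
          div_pos (mul_pos (by linarith) ha2) (by linarith)
        gcongr
      _ = (1 - ε) * t * a ^ 2 := by field_simp
  · have hnl := (ht2 v n h0 hs hn).1
    obtain ⟨-, hvk₀⟩ := ht1 v n h0 hs hn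
    have herr : ∀ i, k₀ + i ≤ n → ‖v (k₀ + i) - u (k₀ + i)‖ ≤ K ^ i * (A' * √t) ∧
        ‖v (k₀ + i) - D‖ ≤ ρ := by
      intro i
      have hball : ∀ i, ‖v (k₀ + i) - u (k₀ + i)‖ ≤ K ^ i * (A' * √t) →
          ‖v (k₀ + i) - D‖ ≤ ρ := by
        intro i hi
        have h1 := mul_le_mul_of_nonneg_right (pow_le_one₀ hK0 hK1.le (n := i))
          (show 0 ≤ A' * √t by positivity)
        have h2 := huball (k₀ + i) (by omega)
        have h3 := norm_sub_le_norm_sub_add_norm_sub (v (k₀ + i)) (u (k₀ + i)) D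
        linarith
      induction i with
      | zero =>
        intro _
        have h1 : ‖v (k₀ + 0) - u (k₀ + 0)‖ ≤ K ^ 0 * (A' * √t) := by simpa using hvk₀
        exact ⟨h1, hball 0 h1⟩
      | succ i ih =>
        intro hi
        obtain ⟨h1, h2⟩ := ih (by omega)
        have hvD : v (k₀ + i) ≠ D := fun heq => by
          have := (hs (k₀ + i) (by omega)).1
          rw [heq, coordRed_self hD] at this
          linarith
        have hu2 : ‖u (k₀ + i) - D‖ ≤ ρ := (huball (k₀ + i) (by omega)).trans (by linarith)
        have h3 := hcon _ _ h2 hu2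
        rw [← hstep _ _ h2 hvD (hs (k₀ + i) (by omega)).2,
          ← hstep _ _ hu2 (hne _) (hties (k₀ + i))] at h3
        have h4 : ‖v (k₀ + (i + 1)) - u (k₀ + (i + 1))‖ ≤ K ^ (i + 1) * (A' * √t) :=
          calc ‖v (k₀ + (i + 1)) - u (k₀ + (i + 1))‖ ≤ K * ‖v (k₀ + i) - u (k₀ + i)‖ := h3
            _ ≤ K * (K ^ i * (A' * √t)) := by gcongr
            _ = K ^ (i + 1) * (A' * √t) := by ring
        exact ⟨h4, hball (i + 1) h4⟩
    have hsmallerr : ∀ k, k₀ + l ≤ k → k ≤ n → ‖v k - D‖ ≤ ρ ∧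
        (1 + 1 / (ε / 2)) * (B * ‖v k - u k‖ ^ 2) ≤ ε / 4 * t := by
      intro k hk hkn
      obtain ⟨i, rfl⟩ := Nat.exists_eq_add_of_le (show k₀ ≤ k by omega)
      obtain ⟨h1, h2⟩ := herr i hkn
      refine ⟨h2, ?_⟩
      have h3 : K ^ i ≤ K ^ l := pow_le_pow_of_le_one hK0 hK1.le (by omega)
      calc (1 + 1 / (ε / 2)) * (B * ‖v (k₀ + i) - u (k₀ + i)‖ ^ 2)
          ≤ (1 + 1 / (ε / 2)) * (B * (K ^ l * (A' * √t)) ^ 2) := by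
            gcongr
            exact h1.trans (by gcongr)
        _ = (1 + 1 / (ε / 2)) * (B * (K ^ l * A') ^ 2) * t := by
            rw [← mul_assoc (K ^ l), mul_pow _ (√t), Real.sq_sqrt ht0.le]; ring
        _ ≤ ε / 4 * t := by gcongr
    have hε2 : 0 < ε / 2 := by linarith
    constructor
    · by_contra! hlt
      obtain ⟨h1, h2⟩ := hsmallerr n hnl le_rfl
      have h3 := hRed (u n) (v n) ((huball n (by omega)).trans (by linarith)) h1 (ε / 2) hε2
      rw [norm_sub_rev] at h3
      have h4 := hn₁m n hlt
      have h5 : (1 + ε / 2) * coordRed θ (v n) ≤ (1 + ε / 2) * t := by gcongr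
      nlinarith
    · by_contra! hlt
      obtain ⟨h1, h2⟩ := hsmallerr n₂ hlt2.le hlt.le
      have h3 := hRed (v n₂) (u n₂) h1 ((huball n₂ (by omega)).trans (by linarith)) (ε / 2) hε2
      have h4 := (hs n₂ hlt).1
      have h5 : (1 + ε / 2) * coordRed θ (u n₂) ≤ (1 + ε / 2) * ((1 - ε) * t) := by gcongr
      have h6 : 0 < ε * t := by positivity
      have h7 : 0 < ε ^ 2 * t := by positivity
      nlinarith

end Coordinates

/-! ### The limiting function and its coordinates -/

section LimitRuns

variable {E : Type*} [NormedAddCommGroup E] [InnerProductSpace ℝ E] [CompleteSpace E]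
  [FiniteDimensional ℝ E] {κ ι : Type*} [Fintype κ] [Fintype ι]
  {e : κ → E} {θ : κ → ℝ} {b : ι → E}
  (U : E ≃L[ℝ] (κ → ℝ)) (hU : ∀ ω i, U ω i = inner ℝ (e i) ω)

include hU

lemma inner_newtonDir_ridgeFun (ω : E) (i : κ) :
    inner ℝ (e i) (newtonDir (ridgeFun e θ b 0 0 0) ω) =
      -scalarNewton (θ i) (inner ℝ (e i) ω) := by
  have h : newtonDir (ridgeFun e θ b 0 0 0) ω =
      U.symm fun i => -scalarNewton (θ i) (inner ℝ (e i) ω) := by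
    apply (hasNewtonData_ridgeFun U hU le_rfl le_rfl).newtonDir_eq
    have h1 : ∀ i, inner ℝ (e i) (U.symm fun i => -scalarNewton (θ i) (inner ℝ (e i) ω)) =
        -scalarNewton (θ i) (inner ℝ (e i) ω) := fun i => by rw [← hU]; simp
    simp only [ridgeHess, ridgeGrad, zero_smul, add_zero, sum_apply, smul_apply,
      ContinuousLinearMap.smulRight_apply, innerSL_apply_apply, h1, smul_smul,
      ← Finset.sum_neg_distrib, ← neg_smul]
    refine Finset.sum_congr rfl fun i _ => ?_
    have := (ddpsi_pos (inner ℝ (e i) ω)).ne'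
    congr 1
    unfold scalarNewton
    field_simp
  rw [h, ← hU]
  simp

lemma inner_newtonDir_gradient_ridgeFun (ω : E) :
    inner ℝ (newtonDir (ridgeFun e θ b 0 0 0) ω) (gradient (ridgeFun e θ b 0 0 0) ω) =
      -coordRed θ (U ω) := by
  rw [(hasGradientAt_ridgeFun ω).gradient, real_inner_comm]
  simp only [ridgeGrad, zero_smul, add_zero, sum_inner, real_inner_smul_left,
    inner_newtonDir_ridgeFun U hU, coordRed, hU, scalarResidual_sq, ← Finset.sum_neg_distrib]
  exact Finset.sum_congr rfl fun i _ => by ring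

lemma predictedReduction_ridgeFun (ω : E) :
    predictedReduction (ridgeFun e θ b 0 0 0) ω = coordRed θ (U ω) := by
  rw [predictedReduction, inner_newtonDir_gradient_ridgeFun U hU, abs_neg, abs_of_nonneg]
  exact Finset.sum_nonneg fun i _ => sq_nonneg _

lemma trialValue_sub_armijoBound_ridgeFun (c : ℝ) (ω : E) (j : ℕ) :
    trialValue (ridgeFun e θ b 0 0 0) ω j - armijoBound (ridgeFun e θ b 0 0 0) c ω j =
      coordGap θ c ((1 / 2) ^ j) (U ω) := by
  rw [trialValue, armijoBound, inner_newtonDir_gradient_ridgeFun U hU]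
  simp only [ridgeFun, zero_div, zero_mul, add_zero, inner_add_right, real_inner_smul_right,
    inner_newtonDir_ridgeFun U hU, coordRed, coordGap, scalarGap, hU, scalarResidual_sq,
    mul_neg, ← sub_eq_add_neg]
  rw [Finset.mul_sum, ← Finset.sum_sub_distrib, ← Finset.sum_sub_distrib]
  exact Finset.sum_congr rfl fun i _ => by ring

lemma map_newtonStep_ridgeFun (ω : E) (s : ℝ) :
    U (ω + s • newtonDir (ridgeFun e θ b 0 0 0) ω) = coordStep θ s (U ω) := by
  funext i
  simp only [hU, coordStep, inner_add_right, real_inner_smul_right,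
    inner_newtonDir_ridgeFun U hU]
  ring

lemma IsGuardedStepTies.coord {c : ℝ} {ω ω' : E}
    (h : IsGuardedStepTies (ridgeFun e θ b 0 0 0) c ω ω') :
    CoordTiesStep θ c (U ω) (U ω') := by
  obtain ⟨j, h1, h2, rfl⟩ := h
  simp only [CoordTiesStep, ← trialValue_sub_armijoBound_ridgeFun (b := b) U hU]
  exact ⟨j, sub_nonpos.2 h1, fun i hi => sub_nonneg.2 (h2 i hi), map_newtonStep_ridgeFun U hU _ _⟩

lemma ridgeFun_lt_of_ne {d : E} (hd : ∀ i, dpsi (inner ℝ (e i) d) = θ i) {ω : E} (hω : ω ≠ d) :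
    ridgeFun e θ b 0 0 0 d < ridgeFun e θ b 0 0 0 ω := by
  obtain ⟨i, hi⟩ := Function.ne_iff.1 (U.injective.ne hω)
  rw [hU, hU] at hi
  have h : ∀ i, (psi (inner ℝ (e i) ω) - θ i * inner ℝ (e i) ω)
      - (psi (inner ℝ (e i) d) - θ i * inner ℝ (e i) d)
      = psiQuot (inner ℝ (e i) d) (inner ℝ (e i) ω) * (inner ℝ (e i) ω - inner ℝ (e i) d) ^ 2 := by
    intro i
    rw [← psi_sub_eq, hd]; ring
  rw [← sub_pos]
  simp only [ridgeFun, zero_div, zero_mul, add_zero]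
  rw [← Finset.sum_sub_distrib]
  simp only [h]
  refine Finset.sum_pos' (fun i _ => mul_nonneg (psiQuot_pos _ _).le (sq_nonneg _))
    ⟨i, Finset.mem_univ i, mul_pos (psiQuot_pos _ _) ?_⟩
  have := sub_ne_zero.2 hi
  positivity

/-- Step counts of the limiting problem from starting points near `β⁻¹ d`. -/
theorem eventually_limit_stepCount (hθ : ∀ i, 0 < θ i ∧ θ i < 1) {d : E}
    (hd : ∀ i, dpsi (inner ℝ (e i) d) = θ i) {β c ε : ℝ} (hβ : 0 < β) (hc0 : 0 < c) (hc1 : c < 1)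
    {run : ℕ → E} (hrun0 : run 0 = β⁻¹ • d)
    (hrun : ∀ k, IsGuardedStep (ridgeFun e θ b 0 0 0) c (run k) (run (k + 1)))
    (hne : ∀ k, run k ≠ d) (htie : ∀ k, NoArmijoTie (ridgeFun e θ b 0 0 0) c (run k))
    (hc : ∀ j : ℕ, c ≠ 1 - (1 / 2 : ℝ) ^ (j + 1)) (hε0 : 0 < ε) (hε1 : ε < 1) :
    ∀ᶠ t in 𝓝[>] (0 : ℝ), ∃ n₁ n₂ : ℕ,
      StopsAfter (ridgeFun e θ b 0 0 0) c ((1 + ε) * t) (β⁻¹ • d) n₁ ∧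
      StopsAfter (ridgeFun e θ b 0 0 0) c ((1 - ε) * t) (β⁻¹ • d) n₂ ∧
      (c < 1 / 2 → n₂ ≤ n₁ + 1) ∧
      ∀ (ω₀ : E) (n : ℕ), predictedReduction (ridgeFun e θ b 0 0 0) (β • ω₀) ≤ t →
        StopsAfterTies (ridgeFun e θ b 0 0 0) c t ω₀ n → n₁ ≤ n ∧ n ≤ n₂ := by
  have hD : ∀ i, dpsi (U d i) = θ i := fun i => by rw [hU]; exact hd i
  obtain ⟨a, ha, hale⟩ := exists_le_coordRed hD
  have hgap := fun ω j => trialValue_sub_armijoBound_ridgeFun (θ := θ) (b := b) U hU c ω j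
  have hred := fun ω => predictedReduction_ridgeFun (θ := θ) (b := b) U hU ω
  have hstrict : ∀ k, ∃ j : ℕ, coordGap θ c ((1 / 2) ^ j) (U (run k)) < 0 ∧
      (∀ i < j, 0 < coordGap θ c ((1 / 2) ^ i) (U (run k))) ∧
      U (run (k + 1)) = coordStep θ ((1 / 2) ^ j) (U (run k)) := by
    intro k
    obtain ⟨j, h1, h2, h3⟩ := hrun k
    refine ⟨j, ?_, fun i hi => ?_, ?_⟩
    · rw [← hgap, sub_neg]
      exact lt_of_le_of_ne h1 (htie k j h2)
    · rw [← hgap, sub_pos]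
      exact h2 i hi
    · rw [h3, map_newtonStep_ridgeFun U hU]
  have hconv : ∀ ρ > 0, ∃ k, ‖U (run k) - U d‖ < ρ := by
    intro ρ hρ
    by_contra! hfar
    obtain ⟨m, hm, hB⟩ := exists_newtonBounds (b := b) U hU hθ (ridgeFun e θ b 0 0 0 (run 0))
    have hL := curvBound_pos e b
    obtain ⟨J, hJ⟩ := exists_pow_half_mul_lt hc1 hm hL
    have htol : 0 < (a * min 1 ρ) ^ 2 := by positivity
    have := (hB 0 0 0 le_rfl zero_le_one le_rfl zero_le_one).steps_le hm hL.le hc0 hJ htol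
      (w := run) (n := ⌊ridgeFun e θ b 0 0 0 (run 0) / (c * (1 / 2) ^ J * (a * min 1 ρ) ^ 2)⌋₊ + 1)
      le_rfl fun k _ => ⟨by
        rw [hred]
        refine le_trans ?_ (hale _)
        have := hfar k
        gcongr, (hrun k).ties⟩
    omega
  have key := eventually_coord_stepCount (A := β⁻¹ * a⁻¹) hD hc0 hc1 hc hε0 hε1
    (u := fun k => U (run k)) hstrict (fun k => U.injective.ne (hne k)) hconv
  filter_upwards [key, Ioo_mem_nhdsGT (show 0 < a ^ 2 by positivity)] with t ht ⟨ht0, hta⟩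
  obtain ⟨n₁, n₂, ⟨h1, h1'⟩, ⟨h2, h2'⟩, h3, h4⟩ := ht
  refine ⟨n₁, n₂, ⟨run, hrun0, fun k hk => ⟨?_, hrun k⟩, ?_⟩,
    ⟨run, hrun0, fun k hk => ⟨?_, hrun k⟩, ?_⟩, h3, ?_⟩
  · rw [hred]; exact h1 k hk
  · rw [hred]; exact h1'
  · rw [hred]; exact h2 k hk
  · rw [hred]; exact h2'
  · rintro ω₀ n hω₀ ⟨w, rfl, hs, hn⟩
    refine h4 (fun k => U (w k)) n ?_ (fun i hi => ⟨?_, (hs i hi).2.coord U hU⟩) ?_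
    · rw [hred] at hω₀
      have h5 : a * min 1 ‖U (β • w 0) - U d‖ ≤ √t :=
        Real.le_sqrt_of_sq_le ((hale _).trans hω₀)
      have h6 : √t < a := by
        rw [Real.sqrt_lt' ha]; exact hta
      have h7 : min 1 ‖U (β • w 0) - U d‖ = ‖U (β • w 0) - U d‖ := by
        refine min_eq_right (not_lt.1 fun h => ?_)
        rw [min_eq_left h.le] at h5
        linarith
      rw [h7] at h5
      have h8 : U (w 0) - U (run 0) = β⁻¹ • (U (β • w 0) - U d) := by
        rw [hrun0, map_smul, map_smul, smul_sub, smul_smul, inv_mul_cancel₀ hβ.ne', one_smul]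
      rw [h8, norm_smul, Real.norm_eq_abs, abs_of_pos (inv_pos.2 hβ), mul_assoc]
      gcongr
      rw [inv_mul_eq_div, le_div_iff₀ ha]
      linarith
    · rw [← hred]; exact (hs i hi).1
    · rw [← hred]; exact hn

end LimitRuns

/-! ### The smoothed support vector machine objective after rescaling -/

section SVM

variable {m N : ℕ} (x : Fin N → EuclideanSpace ℝ (Fin m)) (y : Fin N → ℝ)
  (wstar : EuclideanSpace ℝ (Fin m))

/-- The signed data points: `yⱼ xⱼ`, with reversed sign if `xⱼ` violates the margin. -/
noncomputable def signedPoint (j : Fin N) : EuclideanSpace ℝ (Fin m) :=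
  if y j * inner ℝ (x j) wstar < 1 then -(y j • x j) else y j • x j

/-- The distance of the margin of `xⱼ` from `1`. -/
noncomputable def marginDist (j : Fin N) : ℝ := |1 - y j * inner ℝ (x j) wstar|

variable {x y wstar}

/-- In the variable `ω = (w* - w) / α` the smoothed objective is, up to a positive factor and an
additive constant, the limiting function plus terms that vanish as `α → 0`. The reflection
`ψ(u) = ψ(-u) + u` turns the terms of the violated points into such terms; the linear terms that it
leaves cancel by the equation for `θ`. -/
lemma smoothed_eq_ridgeFun (hN : 0 < N) {lam : ℝ} {I : Finset (Fin N)}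
    (hI : I = marginSet x y wstar) {θ : Fin N → ℝ}
    (hθ : ∑ i ∈ I, (θ i * y i) • x i + ∑ j ∈ violatedSet x y wstar, y j • x j
        - ((N : ℝ) * lam) • wstar = 0) {α : ℝ} (hα : 0 < α) (ω : EuclideanSpace ℝ (Fin m)) :
    smoothed lam x y α (wstar + (-α) • ω) =
      α / N * ridgeFun (fun i : {i // i ∈ I} => y i • x i) (fun i => θ i)
        (fun j : {j // j ∉ I} => signedPoint x y wstar j) (N * lam * α) 1
        (fun j => -marginDist x y wstar j / α) ω
      + (1 / 2 * lam * ‖wstar‖ ^ 2 +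
        1 / N * ∑ j ∈ violatedSet x y wstar, (1 - y j * inner ℝ (x j) wstar)) := by
  classical
  have hN0 : (N : ℝ) ≠ 0 := by positivity
  have hterm : ∀ j, psi ((1 - y j * inner ℝ (x j) (wstar + (-α) • ω)) / α) =
      psi (-marginDist x y wstar j / α + inner ℝ (signedPoint x y wstar j) ω) +
      (if j ∈ violatedSet x y wstar then
        (1 - y j * inner ℝ (x j) wstar) / α + y j * inner ℝ (x j) ω else 0) := by
    intro j
    have h1 : (1 - y j * inner ℝ (x j) (wstar + (-α) • ω)) / α =
        (1 - y j * inner ℝ (x j) wstar) / α + y j * inner ℝ (x j) ω := by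
      rw [inner_add_right, real_inner_smul_right]
      field_simp
      ring
    rw [h1, marginDist, signedPoint]
    by_cases hj : y j * inner ℝ (x j) wstar < 1
    · rw [if_pos hj, if_pos (by simpa [violatedSet] using hj), abs_of_pos (by linarith),
        inner_neg_left, real_inner_smul_left, neg_div, ← neg_add, psi_neg]
      ring
    · rw [if_neg hj, if_neg (by simpa [violatedSet] using hj),
        abs_of_nonpos (by linarith [not_lt.1 hj]), real_inner_smul_left, neg_neg, add_zero]
  have hsplit : ∑ j, psi (-marginDist x y wstar j / α + inner ℝ (signedPoint x y wstar j) ω) =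
      ∑ i : {i // i ∈ I}, psi (inner ℝ (y i • x i) ω) +
      ∑ j : {j // j ∉ I}, psi (-marginDist x y wstar j / α +
        inner ℝ (signedPoint x y wstar j) ω) := by
    rw [← Fintype.sum_subtype_add_sum_subtype (fun j => j ∈ I)]
    congr 1
    refine Finset.sum_congr (by ext; simp) fun i _ => ?_
    have hi : 1 = y i * inner ℝ (x i) wstar := by
      simpa [marginSet] using (Finset.ext_iff.1 hI _).1 i.2
    rw [marginDist, signedPoint, ← hi]
    simp
  have hlin : ∑ i : {i // i ∈ I}, θ i * inner ℝ (y i • x i) ω +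
      ∑ j ∈ violatedSet x y wstar, y j * inner ℝ (x j) ω = N * lam * inner ℝ wstar ω := by
    have := congrArg (fun z => inner ℝ z ω) hθ
    simp only [inner_sub_left, inner_add_left, sum_inner, real_inner_smul_left,
      inner_zero_left] at this
    have h2 : ∑ i : {i // i ∈ I}, θ i * inner ℝ (y i • x i) ω =
        ∑ i ∈ I, θ i * y i * inner ℝ (x i) ω := by
      rw [← Finset.sum_coe_sort I]
      exact Finset.sum_congr rfl fun i _ => by rw [real_inner_smul_left]; ring
    rw [h2]
    linarith
  have hviol : ∑ j ∈ violatedSet x y wstar, (1 - y j * inner ℝ (x j) wstar) =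
      α * ∑ j ∈ violatedSet x y wstar, (1 - y j * inner ℝ (x j) wstar) / α := by
    rw [Finset.mul_sum]
    exact Finset.sum_congr rfl fun j _ => by field_simp
  have hnorm : ‖wstar + (-α) • ω‖ ^ 2 =
      ‖wstar‖ ^ 2 - 2 * α * inner ℝ wstar ω + α ^ 2 * ‖ω‖ ^ 2 := by
    rw [norm_add_sq_real, real_inner_smul_right, norm_smul, mul_pow, Real.norm_eq_abs, sq_abs]
    ring
  unfold smoothed ridgeFun
  rw [hnorm, ← Finset.mul_sum, hviol]
  simp only [hterm]
  rw [Finset.sum_add_distrib, hsplit, Finset.sum_ite_mem, Finset.univ_inter,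
    Finset.sum_add_distrib, Finset.sum_sub_distrib]
  field_simp
  linear_combination (2 * α) * hlin

lemma limitFun_eq_ridgeFun {ι : Type*} [Fintype ι] (b : ι → EuclideanSpace ℝ (Fin m))
    (I : Finset (Fin N)) (θ : Fin N → ℝ) :
    limitFun x y I θ = ridgeFun (fun i : {i // i ∈ I} => y i • x i) (fun i => θ i) b 0 0 0 := by
  funext ω
  simp only [limitFun, ridgeFun, zero_div, zero_mul, add_zero, real_inner_smul_left]
  exact (Finset.sum_coe_sort I
    fun i => psi (y i * inner ℝ (x i) ω) - θ i * (y i * inner ℝ (x i) ω)).symm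

lemma exists_coordinates (hy : ∀ i, y i = 1 ∨ y i = -1) {I : Finset (Fin N)} (hcard : I.card = m)
    (hindep : LinearIndependent ℝ (fun i : I => x i)) :
    ∃ U : EuclideanSpace ℝ (Fin m) ≃L[ℝ] ({i // i ∈ I} → ℝ),
      ∀ ω i, U ω i = inner ℝ (y i • x i) ω := by
  let L : EuclideanSpace ℝ (Fin m) →ₗ[ℝ] ({i // i ∈ I} → ℝ) :=
    LinearMap.pi fun i => (innerSL ℝ (y i • x i)).toLinearMap
  have hL : ∀ ω i, L ω i = inner ℝ (y i • x i) ω := fun ω i => rfl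
  have hdim : Module.finrank ℝ (EuclideanSpace ℝ (Fin m)) =
      Module.finrank ℝ ({i // i ∈ I} → ℝ) := by
    simp [hcard]
  have hinj : Function.Injective L := by
    rw [injective_iff_map_eq_zero]
    intro v hv
    have hspan : Submodule.span ℝ (Set.range fun i : I => x i) = ⊤ :=
      hindep.span_eq_top_of_card_eq_finrank' (by simp [hcard])
    have hall : ∀ z ∈ Submodule.span ℝ (Set.range fun i : I => x i), inner ℝ z v = 0 := by
      intro z hz
      induction hz using Submodule.span_induction with
      | mem z hz =>
        obtain ⟨i, rfl⟩ := hz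
        have h1 := congrFun hv i
        rw [hL, real_inner_smul_left] at h1
        have h2 : y i ≠ 0 := by rcases hy i with h | h <;> rw [h] <;> norm_num
        exact (mul_eq_zero.1 h1).resolve_left h2
      | zero => exact inner_zero_left _
      | add z z' _ _ h h' => rw [inner_add_left, h, h', add_zero]
      | smul a z _ h => rw [real_inner_smul_left, h, mul_zero]
    exact inner_self_eq_zero.1 (hall v (by rw [hspan]; trivial))
  exact ⟨(LinearMap.linearEquivOfInjective L hinj hdim).toContinuousLinearEquiv,
    fun ω i => rfl⟩

lemma exists_forall_lt_of_eventually {P : ℝ → Prop} (h : ∀ᶠ t in 𝓝[>] (0 : ℝ), P t) :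
    ∃ r > 0, ∀ t, 0 < t → t < r → P t := by
  obtain ⟨r, hr, H⟩ := mem_nhdsGT_iff_exists_Ioo_subset.1 h
  exact ⟨r, hr, fun t h0 h1 => H ⟨h0, h1⟩⟩

end SVM

end SmSVM

theorem mainTheorem2 {m N : ℕ} (hN : 0 < N)
    (x : Fin N → EuclideanSpace ℝ (Fin m)) (y : Fin N → ℝ) (hy : ∀ i, y i = 1 ∨ y i = -1)
    (lam : ℝ) (hlam : 0 ≤ lam)
    (wstar : EuclideanSpace ℝ (Fin m))
    (hmin : ∀ w, SmSVM.softMargin lam x y wstar ≤ SmSVM.softMargin lam x y w)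
    (I : Finset (Fin N)) (hI : I = SmSVM.marginSet x y wstar) (hcard : I.card = m)
    (hindep : LinearIndependent ℝ (fun i : I => x i))
    (θ : Fin N → ℝ)
    (hθ : ∑ i ∈ I, (θ i * y i) • x i + ∑ j ∈ SmSVM.violatedSet x y wstar, y j • x j
        - ((N : ℝ) * lam) • wstar = 0)
    (hθ01 : ∀ i ∈ I, 0 < θ i ∧ θ i < 1)
    (β : ℝ) (hβ0 : 0 < β) (hβ1 : β < 1)
    (c : ℝ) (hc0 : 0 < c) (hc1 : c < 1) :
    ∃ d : EuclideanSpace ℝ (Fin m),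
      (∀ ω, ω ≠ d → SmSVM.limitFun x y I θ d < SmSVM.limitFun x y I θ ω) ∧
      -- the step counts are those of the limiting problem, and they are bounded
      (∃ η₀ > 0, ∀ η : ℝ, 0 < η → η < η₀ →
        (∃ M : ℕ, ∀ (ω₀ : EuclideanSpace ℝ (Fin m)) (n : ℕ),
          SmSVM.predictedReduction (SmSVM.limitFun x y I θ) (β • ω₀) ≤ N * η →
          SmSVM.StopsAfterTies (SmSVM.limitFun x y I θ) c (N * η) ω₀ n → n ≤ M) ∧
        (∃ α₀ > 0, ∀ α : ℝ, 0 < α → α < α₀ → ∀ w : EuclideanSpace ℝ (Fin m),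
          SmSVM.predictedReduction (SmSVM.smoothed lam x y α) w < η * α →
          ∃ n : ℕ, SmSVM.StopsAfter (SmSVM.smoothed lam x y (β * α)) c (η * (β * α)) w n ∧
            ∃ ω₀ : EuclideanSpace ℝ (Fin m),
              SmSVM.predictedReduction (SmSVM.limitFun x y I θ) (β • ω₀) ≤ N * η ∧
              SmSVM.StopsAfterTies (SmSVM.limitFun x y I θ) c (N * η) ω₀ n)) ∧
      -- for small `η` the step count is that of the limiting run started at `β⁻¹ • d`
      (∀ run : ℕ → EuclideanSpace ℝ (Fin m), run 0 = β⁻¹ • d →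
        (∀ k, SmSVM.IsGuardedStep (SmSVM.limitFun x y I θ) c (run k) (run (k + 1))) →
        (∀ k, run k ≠ d) →
        (∀ k, SmSVM.NoArmijoTie (SmSVM.limitFun x y I θ) c (run k)) →
        (∀ j : ℕ, c ≠ 1 - (1 / 2 : ℝ) ^ (j + 1)) →
        ∀ ε : ℝ, 0 < ε → ε < 1 → ∃ η₀ > 0, ∀ η : ℝ, 0 < η → η < η₀ →
          ∃ n₁ n₂ : ℕ,
            SmSVM.StopsAfter (SmSVM.limitFun x y I θ) c ((1 + ε) * (N * η)) (β⁻¹ • d) n₁ ∧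
            SmSVM.StopsAfter (SmSVM.limitFun x y I θ) c ((1 - ε) * (N * η)) (β⁻¹ • d) n₂ ∧
            (c < 1 / 2 → n₂ ≤ n₁ + 1) ∧
            ∃ α₀ > 0, ∀ α : ℝ, 0 < α → α < α₀ → ∀ w : EuclideanSpace ℝ (Fin m),
              SmSVM.predictedReduction (SmSVM.smoothed lam x y α) w < η * α →
              ∃ n : ℕ, SmSVM.StopsAfter (SmSVM.smoothed lam x y (β * α)) c (η * (β * α)) w n ∧
                n₁ ≤ n ∧ n ≤ n₂) := by
  classical
  open SmSVM Filter Topology in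
  have hNpos : (0 : ℝ) < N := by exact_mod_cast hN
  obtain ⟨U, hU⟩ := exists_coordinates hy hcard hindep
  let e : {i // i ∈ I} → EuclideanSpace ℝ (Fin m) := fun i => y i • x i
  let θ' : {i // i ∈ I} → ℝ := fun i => θ i
  let b : {j // j ∉ I} → EuclideanSpace ℝ (Fin m) := fun j => signedPoint x y wstar j
  have hθ' : ∀ i, 0 < θ' i ∧ θ' i < 1 := fun i => hθ01 i i.2
  have hUe : ∀ ω i, U ω i = inner ℝ (e i) ω := hU
  have hlim : limitFun x y I θ = ridgeFun e θ' b 0 0 0 := limitFun_eq_ridgeFun b I θ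
  choose D hD using fun i => exists_dpsi_eq (hθ' i).1 (hθ' i).2
  have hd : ∀ i, dpsi (inner ℝ (e i) (U.symm D)) = θ' i := fun i => by
    rw [← hUe, ContinuousLinearEquiv.apply_symm_apply]; exact hD i
  let Q : ℝ → ℝ := fun α => N * lam * α
  let T : ℝ → {j // j ∉ I} → ℝ := fun α j => -marginDist x y wstar j / α
  have hQ0 : ∀ α, 0 < α → 0 ≤ Q α := fun α hα => by simp only [Q]; positivity
  have hT0 : ∀ α, 0 < α → ∀ j, T α j ≤ 0 := fun α hα j =>
    div_nonpos_of_nonpos_of_nonneg (neg_nonpos.2 (abs_nonneg _)) hα.le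
  have hQ : Tendsto Q (𝓝[>] 0) (𝓝 0) := by
    have : Tendsto Q (𝓝 0) (𝓝 (N * lam * 0)) := (continuous_const_mul _).tendsto 0
    rw [mul_zero] at this
    exact this.mono_left nhdsWithin_le_nhds
  have hT : ∀ j, Tendsto (fun α => T α j) (𝓝[>] 0) atBot := by
    intro j
    have hj : 0 < marginDist x y wstar j := by
      refine abs_pos.2 (sub_ne_zero.2 fun h => j.2 ?_)
      exact (Finset.ext_iff.1 hI _).2 (by simpa [marginSet] using h)
    exact tendsto_inv_nhdsGT_zero.const_mul_atTop_of_neg (neg_neg_of_pos hj)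
  obtain ⟨t₀, ht₀, hstep⟩ := exists_threshold_stepCount (b := b) U hUe hθ' hd hβ0 hc0 hc1
    hQ0 hT0 hQ hT
  have hdata : ∀ α, 0 < α → HasNewtonData (ridgeFun e θ' b (Q α) 1 (T α))
      (ridgeGrad e θ' b (Q α) 1 (T α)) (ridgeHess e b (Q α) 1 (T α)) := fun α hα =>
    hasNewtonData_ridgeFun U hUe (hQ0 α hα) zero_le_one
  -- the count for the smoothed objectives, back in the original variable
  have hcount : ∀ η, 0 < η → η < t₀ / N →
      ∃ α₀ > 0, ∀ α : ℝ, 0 < α → α < α₀ → ∀ w : EuclideanSpace ℝ (Fin m),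
        predictedReduction (smoothed lam x y α) w < η * α →
        ∃ n : ℕ, StopsAfter (smoothed lam x y (β * α)) c (η * (β * α)) w n ∧
          ∃ ω₀ : EuclideanSpace ℝ (Fin m),
            predictedReduction (limitFun x y I θ) (β • ω₀) ≤ N * η ∧
            StopsAfterTies (limitFun x y I θ) c (N * η) ω₀ n := by
    intro η hη hη0
    rw [lt_div_iff₀ hNpos, mul_comm] at hη0
    obtain ⟨α₀, hα₀, H⟩ := exists_forall_lt_of_eventually
      (hstep (N * η) (by positivity) hη0).2
    refine ⟨α₀, hα₀, fun α hα hαα w hw => ?_⟩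
    have hβα : 0 < β * α := mul_pos hβ0 hα
    set ω := (-α)⁻¹ • (w - wstar) with hω
    have hwω : wstar + (-α) • ω = w := by
      rw [hω, smul_smul, mul_inv_cancel₀ (neg_ne_zero.2 hα.ne'), one_smul, add_sub_cancel]
    have hred : predictedReduction (ridgeFun e θ' b (Q α) 1 (T α)) ω < N * η := by
      rw [← hwω, predictedReduction_rescale (hdata α hα) (neg_ne_zero.2 hα.ne')
        (show 0 < α / N by positivity) (smoothed_eq_ridgeFun hN hI hθ hα) ω] at hw
      rw [div_mul_eq_mul_div, div_lt_iff₀ hNpos] at hw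
      exact lt_of_mul_lt_mul_left (by linarith) hα.le
    obtain ⟨n, hn, hω₀⟩ := H α hα hαα ω hred
    refine ⟨n, ?_, by rw [hlim]; exact hω₀⟩
    have h1 := hn.rescale (hdata _ hβα) (neg_ne_zero.2 hβα.ne')
      (show 0 < β * α / N by positivity) (smoothed_eq_ridgeFun hN hI hθ hβα)
    have h2 : wstar + (-(β * α)) • β⁻¹ • ω = w := by
      rw [← hwω, smul_smul]
      congr 2
      field_simp
    have h3 : β * α / N * (N * η) = η * (β * α) := by field_simp
    rwa [h2, h3] at h1
  refine ⟨U.symm D, fun ω hω => ?_, ⟨t₀ / N, by positivity, fun η hη hη0 => ⟨?_, hcount η hη hη0⟩⟩,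
    ?_⟩
  · rw [hlim]
    exact ridgeFun_lt_of_ne U hUe hd hω
  · rw [lt_div_iff₀ hNpos, mul_comm] at hη0
    rw [hlim]
    exact (hstep (N * η) (by positivity) hη0).1
  · intro run hrun0 hrun hne htie hc ε hε0 hε1
    simp only [hlim] at hrun htie
    obtain ⟨t₁, ht₁, H⟩ := exists_forall_lt_of_eventually
      (eventually_limit_stepCount U hUe hθ' hd hβ0 hc0 hc1 hrun0 hrun hne htie hc hε0 hε1)
    refine ⟨min (t₀ / N) (t₁ / N), by positivity, fun η hη hη0 => ?_⟩
    have hη1 := hη0.trans_le (min_le_right _ _)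
    rw [lt_div_iff₀ hNpos, mul_comm] at hη1
    obtain ⟨n₁, n₂, h1, h2, h3, h4⟩ := H (N * η) (by positivity) hη1
    obtain ⟨α₀, hα₀, hα⟩ := hcount η hη (hη0.trans_le (min_le_left _ _))
    rw [hlim] at hα ⊢
    refine ⟨n₁, n₂, h1, h2, h3, α₀, hα₀, fun α hα0 hαα w hw => ?_⟩
    obtain ⟨n, hn, ω₀, hω₀, hties⟩ := hα α hα0 hαα w hw
    exact ⟨n, hn, h4 ω₀ n hω₀ hties⟩
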